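/- Let $P$ be a finite set of qubits, $V=\mathbb F_2\oplus\mathbb F_2$ with base $(z,x)$ and its symplectic form, and let $L\subset V^P$ be a subspace on which the induced symplectic form $\omega$ of $V^P$ vanishes identically. For $S\subset P$ put $L_S=\{v\in L\mid v_p=0 \text{ for all } p\notin S\}$, and assume that $L$ does not split off a zero factor, i.e. there is no nonempty $S\subset P$ with $L=L_S\oplus L_{P\setminus S}$ and $L_S=0$. Let $\tilde V^P\subset U((\mathbb C^2)^{\otimes P})$ be the Pauli group, generated by the unitary scalars and all tensor products of Pauli operators, with its natural projection to $V^P$ (whose kernel consists of the scalars), let $\sigma\colon L\to\tilde V^P$ be any homomorphic section of this projection over $L$, and let $C=C(L,\sigma)\subset(\mathbb C^2)^{\otimes P}$ be the common fixed space of the operators $\sigma(v)$, $v\in L$. Identify $U(2)/S^1$ with $SO(3)$ by the adjoint action on traceless Hermitian operators. Let $A(L,\sigma)$ be the group of all $g\in SO(3)^P$ such that, for some $\tilde g\in U(2)^P$ representing $g$, the operator $\bigotimes_p\tilde g_p$ maps $C$ into itself, and let $Z(L,\sigma)$ be the normal subgroup of those $g$ for which moreover $\bigotimes_p\tilde g_p$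 acts on $C$ as a scalar for some such $\tilde g$. Then the group $\overline A(L,\sigma)=A(L,\sigma)/Z(L,\sigma)$ of transversally realisable logical operators, with its quotient topology, is a solvable compact Lie group. In particular, no universal set of gates on even one logical qubit can be realised transversally, not even approximately: let $d=|P|-\dim L$, let $\varphi\colon C\to(\mathbb C^2)^{\otimes d}$ be any linear isomorphism, let $j\in\{1,\dots,d\}$, and let $\mathcal G\subset U((\mathbb C^2)^{\otimes d})$ be a set such that the closure of the group generated by $\mathcal G$ and the unitary scalars contains every operator that acts as some $u\in U(2)$ on the $j$-th factor and as the identity on the other factors. Then there is $W\in\mathcal G$ that has no approximate transversal realisations; that is, for some $\varepsilon>0$ there are no $\tilde g\in U(2)^P$ and $c\in\mathbb C$ with $|c|=1$ such that $$\Bigl\|\bigotimes_p\tilde g_p\,\psi-c\,\varphi^{-1}W\varphi\,\psi\Bigr\|\le\varepsilon\|\psi\|\quad\text{for all }\psi\in C.$$ -/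

import Mathlib

open scoped ContDiff Manifold

noncomputable section

namespace StabCode

/-! ### Binary symplectic geometry -/

/-- The plane `V = 𝔽₂ ⊕ 𝔽₂`; the coordinates refer to the standard base `(z, x)`. -/
abbrev V : Type := ZMod 2 × ZMod 2

section Symplectic

variable {P : Type*}

/-- The symplectic form on `V ^ P`, the sum over all qubits of the symplectic form of `V`. -/
def omega [Fintype P] (v w : P → V) : ZMod 2 :=
  ∑ p, ((v p).1 * (w p).2 - (v p).2 * (w p).1)

/-- `L` is isotropic: the symplectic form vanishes identically on `L × L`. -/
def IsIsotropic [Fintype P] (L : Submodule (ZMod 2) (P → V)) : Prop :=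
  ∀ v ∈ L, ∀ w ∈ L, omega v w = 0

/-- `V ^ S` as the subspace of all vectors of `V ^ P` that vanish outside `S`. -/
def supportedOn (S : Set P) : Submodule (ZMod 2) (P → V) where
  carrier := {v | ∀ p, p ∉ S → v p = 0}
  add_mem' {v w} hv hw p hp := by simp [hv p hp, hw p hp]
  zero_mem' _ _ := rfl
  smul_mem' c v hv p hp := by simp [hv p hp]

/-- `L_S = L ∩ V ^ S`. -/
def part (L : Submodule (ZMod 2) (P → V)) (S : Set P) : Submodule (ZMod 2) (P → V) :=
  L ⊓ supportedOn S

/-- `L` splits off a zero factor: for some nonempty set `S` of qubits, `L` is the direct product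
of `L_S` and `L_{P \ S}`, and `L_S = 0`. The set `S` may be all of `P`, in which case `L = 0`. -/
def SplitsOffZeroFactor (L : Submodule (ZMod 2) (P → V)) : Prop :=
  ∃ S : Set P, S.Nonempty ∧ L = part L S ⊔ part L Sᶜ ∧ part L S = ⊥

end Symplectic

/-! ### The state space and local operators -/

/-- The unitary group `U(2)`. -/
abbrev U2 : Type := Matrix.unitaryGroup (Fin 2) ℂ

/-- The rotation group `SO(3)`. -/
abbrev SO3 : Type := Matrix.specialOrthogonalGroup (Fin 3) ℝ

section Operators

variable {P : Type*} [Fintype P]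

/-- The state space `(ℂ²)^{⊗ P}`, written in its computational (orthonormal) basis, which is
indexed by the bit strings `P → Fin 2`. -/
abbrev StateSpace (P : Type*) [Fintype P] : Type _ := EuclideanSpace ℂ (P → Fin 2)

/-- The unitary group of the state space. -/
abbrev UnitaryOn (P : Type*) [Fintype P] [DecidableEq P] : Type _ :=
  Matrix.unitaryGroup (P → Fin 2) ℂ

/-- The matrix of the tensor product of one-qubit operators. -/
def tensorMat (M : P → Matrix (Fin 2) (Fin 2) ℂ) : Matrix (P → Fin 2) (P → Fin 2) ℂ :=
  Matrix.of fun a b => ∏ p, M p (a p) (b p)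

theorem tensorMat_one : tensorMat (1 : P → Matrix (Fin 2) (Fin 2) ℂ) = 1 := by
  ext a b
  simp only [tensorMat, Matrix.of_apply, Pi.one_apply]
  by_cases h : a = b
  · subst h; simp
  · obtain ⟨p, hp⟩ := Function.ne_iff.mp h
    rw [Matrix.one_apply_ne h]
    exact Finset.prod_eq_zero (Finset.mem_univ p) (Matrix.one_apply_ne hp)

theorem tensorMat_star (M : P → Matrix (Fin 2) (Fin 2) ℂ) :
    star (tensorMat M) = tensorMat (star M) := by
  ext a b
  simp [tensorMat, Matrix.star_apply]

variable [DecidableEq P]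

theorem tensorMat_mul (M N : P → Matrix (Fin 2) (Fin 2) ℂ) :
    tensorMat (M * N) = tensorMat M * tensorMat N := by
  ext a b
  simp only [tensorMat, Matrix.of_apply, Matrix.mul_apply, Pi.mul_apply]
  rw [Fintype.prod_sum]
  exact Finset.sum_congr rfl fun c _ => Finset.prod_mul_distrib

/-- The local unitary operator `⨂ u_p` on the state space given by a family `u ∈ U(2)^P`. -/
def tensorU : (P → U2) →* UnitaryOn P where
  toFun u := ⟨tensorMat fun p => (u p : Matrix (Fin 2) (Fin 2) ℂ), by
    rw [Matrix.mem_unitaryGroup_iff, tensorMat_star, ← tensorMat_mul, ← tensorMat_one]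
    congr 1
    funext p
    exact Matrix.mem_unitaryGroup_iff.mp (u p).2⟩
  map_one' := Subtype.ext tensorMat_one
  map_mul' u w := Subtype.ext (tensorMat_mul _ _)

/-- The action of a unitary matrix on state vectors. -/
def act (U : UnitaryOn P) : StateSpace P →ₗ[ℂ] StateSpace P :=
  Matrix.toEuclideanLin (U : Matrix (P → Fin 2) (P → Fin 2) ℂ)

theorem act_one : act (1 : UnitaryOn P) = LinearMap.id := by
  ext ψ a
  simp [act]

theorem act_mul (U W : UnitaryOn P) : act (U * W) = act U ∘ₗ act W := by
  ext ψ a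
  simp [act, Matrix.mulVec_mulVec]

theorem act_inv_act (U : UnitaryOn P) (ψ : StateSpace P) : act U⁻¹ (act U ψ) = ψ := by
  rw [← LinearMap.comp_apply, ← act_mul, inv_mul_cancel, act_one, LinearMap.id_apply]

/-! ### The Pauli group -/

/-- The Pauli operator `X`. -/
def pauliX : Matrix (Fin 2) (Fin 2) ℂ := !![0, 1; 1, 0]

/-- The Pauli operator `Y`. -/
def pauliY : Matrix (Fin 2) (Fin 2) ℂ := !![0, -Complex.I; Complex.I, 0]

/-- The Pauli operator `Z`. -/
def pauliZ : Matrix (Fin 2) (Fin 2) ℂ := !![1, 0; 0, -1]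

/-- The Pauli operator `Z ^ a * X ^ b` that represents the vector `a z + b x` of `V`; it is the
identity, `Z`, `X` or `Z X = i Y`. -/
def pauliOf (v : V) : Matrix (Fin 2) (Fin 2) ℂ := pauliZ ^ v.1.val * pauliX ^ v.2.val

/-- `U` is a scalar multiple of the tensor product of Pauli operators given by `v ∈ V ^ P`. -/
def LiesOver (U : UnitaryOn P) (v : P → V) : Prop :=
  ∃ c : ℂ, (U : Matrix (P → Fin 2) (P → Fin 2) ℂ) = c • tensorMat fun p => pauliOf (v p)

/-- The Pauli group, generated by all tensor products of Pauli operators and all (unitary)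
scalars. -/
def pauliGroup (P : Type*) [Fintype P] [DecidableEq P] : Subgroup (UnitaryOn P) :=
  Subgroup.closure {U | ∃ v : P → V, LiesOver U v}

/-- A section `σ` over `L` of the natural projection from the Pauli group to `V ^ P`: a
homomorphism from the additive group `L` that assigns to each `v ∈ L` a Pauli element over `v`. -/
structure Sec (L : Submodule (ZMod 2) (P → V)) where
  /-- The homomorphism from `L` to the Pauli group. -/
  hom : Multiplicative L →* pauliGroup P
  liesOver : ∀ v : L, LiesOver (hom (Multiplicative.ofAdd v) : UnitaryOn P) v

/-- The stabilizer code `C(L, σ)`: the fixed point space of the stabilizer group `σ(L)`. -/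
def code {L : Submodule (ZMod 2) (P → V)} (σ : Sec L) : Submodule ℂ (StateSpace P) where
  carrier := {ψ | ∀ v : L, act (σ.hom (Multiplicative.ofAdd v) : UnitaryOn P) ψ = ψ}
  add_mem' {ψ χ} hψ hχ v := by rw [map_add, hψ v, hχ v]
  zero_mem' v := map_zero _
  smul_mem' c ψ hψ v := by rw [map_smul, hψ v]

end Operators

/-! ### The identification `U(2) / S¹ = SO(3)` -/

/-- The base `X, Y, Z` of the space of traceless Hermitian operators on `ℂ²`. -/
def pauliBase : Fin 3 → Matrix (Fin 2) (Fin 2) ℂ := ![pauliX, pauliY, pauliZ]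

/-- `u ∈ U(2)` represents the rotation `g ∈ SO(3)`: in the base `X, Y, Z`, the matrix of the
adjoint action `T ↦ u T u⁻¹` on traceless Hermitian operators is `g`. -/
def Represents (u : U2) (g : SO3) : Prop :=
  ∀ j, (u : Matrix (Fin 2) (Fin 2) ℂ) * pauliBase j * star (u : Matrix (Fin 2) (Fin 2) ℂ) =
    ∑ i, ((g : Matrix (Fin 3) (Fin 3) ℝ) i j : ℂ) • pauliBase i

theorem Represents.one : Represents 1 1 := by
  intro j
  simp [Matrix.one_apply]

theorem Represents.mul {u w : U2} {g h : SO3} (hu : Represents u g) (hw : Represents w h) :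
    Represents (u * w) (g * h) := by
  intro j
  have key : ((u * w : U2) : Matrix (Fin 2) (Fin 2) ℂ) * pauliBase j *
      star ((u * w : U2) : Matrix (Fin 2) (Fin 2) ℂ) =
      (u : Matrix (Fin 2) (Fin 2) ℂ) * ((w : Matrix (Fin 2) (Fin 2) ℂ) * pauliBase j *
        star (w : Matrix (Fin 2) (Fin 2) ℂ)) * star (u : Matrix (Fin 2) (Fin 2) ℂ) := by
    simp only [Submonoid.coe_mul, star_mul, mul_assoc]
  rw [key, hw j, Finset.mul_sum, Finset.sum_mul]
  simp only [mul_smul_comm, smul_mul_assoc, hu _, Finset.smul_sum, smul_smul]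
  rw [Finset.sum_comm]
  refine Finset.sum_congr rfl fun i _ => ?_
  rw [← Finset.sum_smul]
  congr 1
  simp only [Submonoid.coe_mul, Matrix.mul_apply, Complex.ofReal_sum, Complex.ofReal_mul]
  exact Finset.sum_congr rfl fun k _ => mul_comm _ _

theorem Represents.inv {u : U2} {g : SO3} (hu : Represents u g) : Represents u⁻¹ g⁻¹ := by
  intro j
  have hg : (g : Matrix (Fin 3) (Fin 3) ℝ) * ((g⁻¹ : SO3) : Matrix (Fin 3) (Fin 3) ℝ) = 1 := by
    rw [← Submonoid.coe_mul, mul_inv_cancel, Submonoid.coe_one]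
  have huu : star (u : Matrix (Fin 2) (Fin 2) ℂ) * (u : Matrix (Fin 2) (Fin 2) ℂ) = 1 :=
    Matrix.mem_unitaryGroup_iff'.mp u.2
  have hsum : (u : Matrix (Fin 2) (Fin 2) ℂ) *
      (∑ i, (((g⁻¹ : SO3) : Matrix (Fin 3) (Fin 3) ℝ) i j : ℂ) • pauliBase i) *
      star (u : Matrix (Fin 2) (Fin 2) ℂ) = pauliBase j := by
    rw [Finset.mul_sum, Finset.sum_mul]
    simp only [mul_smul_comm, smul_mul_assoc, hu _, Finset.smul_sum, smul_smul]
    rw [Finset.sum_comm]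
    have : ∀ k, ∑ i, ((((g⁻¹ : SO3) : Matrix (Fin 3) (Fin 3) ℝ) i j : ℂ) *
        ((g : Matrix (Fin 3) (Fin 3) ℝ) k i : ℂ)) • pauliBase k =
        ((1 : Matrix (Fin 3) (Fin 3) ℝ) k j : ℂ) • pauliBase k := by
      intro k
      rw [← Finset.sum_smul, ← hg, Matrix.mul_apply, Complex.ofReal_sum]
      congr 1
      refine Finset.sum_congr rfl fun i _ => ?_
      rw [Complex.ofReal_mul, mul_comm]
    rw [Finset.sum_congr rfl fun k _ => this k]
    simp [Matrix.one_apply]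
  have hinv : ((u⁻¹ : U2) : Matrix (Fin 2) (Fin 2) ℂ) = star (u : Matrix (Fin 2) (Fin 2) ℂ) := rfl
  rw [hinv, star_star, ← hsum]
  simp only [← mul_assoc, huu, one_mul]
  rw [mul_assoc, huu, mul_one]

/-! ### The automorphism group and the group of logical operators -/

section Automorphisms

variable {P : Type*} [Fintype P] [DecidableEq P] {L : Submodule (ZMod 2) (P → V)}

theorem act_inv_mem (C : Submodule ℂ (StateSpace P)) (U : UnitaryOn P)
    (h : ∀ ψ ∈ C, act U ψ ∈ C) : ∀ ψ ∈ C, act U⁻¹ ψ ∈ C := by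
  intro ψ hψ
  let f : C →ₗ[ℂ] C := (act U).restrict h
  have hinj : Function.Injective f := by
    intro a b hab
    apply Subtype.ext
    have := congrArg (fun c : C => act U⁻¹ (c : StateSpace P)) hab
    simpa [f, LinearMap.restrict_apply, act_inv_act] using this
  obtain ⟨χ, hχ⟩ := LinearMap.injective_iff_surjective.mp hinj ⟨ψ, hψ⟩
  have : act U (χ : StateSpace P) = ψ := congrArg Subtype.val hχ
  rw [← this, act_inv_act]
  exact χ.2

/-- The automorphism group `A(L, σ)` of the code: all `g ∈ SO(3)^P` such that some family in
`U(2)^P` that represents `g` sends the code into itself. -/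
def autGroup (σ : Sec L) : Subgroup (P → SO3) where
  carrier := {g | ∃ u : P → U2, (∀ p, Represents (u p) (g p)) ∧
    ∀ ψ ∈ code σ, act (tensorU u) ψ ∈ code σ}
  mul_mem' := by
    rintro g h ⟨u, hu, hu'⟩ ⟨w, hw, hw'⟩
    refine ⟨u * w, fun p => (hu p).mul (hw p), fun ψ hψ => ?_⟩
    rw [map_mul, act_mul]
    exact hu' _ (hw' _ hψ)
  one_mem' := ⟨1, fun _ => Represents.one, fun ψ hψ => by
    rw [map_one, act_one]; exact hψ⟩
  inv_mem' := by
    rintro g ⟨u, hu, hu'⟩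
    refine ⟨u⁻¹, fun p => (hu p).inv, ?_⟩
    rw [map_inv]
    exact act_inv_mem _ _ hu'

/-- The subgroup `Z(L, σ)` of all automorphisms that act by scalars on the code. -/
def scalarGroup (σ : Sec L) : Subgroup (autGroup σ) where
  carrier := {g | ∃ u : P → U2, (∀ p, Represents (u p) ((g : P → SO3) p)) ∧
    ∃ c : ℂ, ∀ ψ ∈ code σ, act (tensorU u) ψ = c • ψ}
  mul_mem' := by
    rintro g h ⟨u, hu, c, hc⟩ ⟨w, hw, d, hd⟩
    refine ⟨u * w, fun p => (hu p).mul (hw p), d * c, fun ψ hψ => ?_⟩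
    rw [map_mul, act_mul, LinearMap.comp_apply, hd ψ hψ, map_smul, hc ψ hψ, smul_smul]
  one_mem' := ⟨1, fun _ => Represents.one, 1, fun ψ _ => by
    rw [map_one, act_one, one_smul, LinearMap.id_apply]⟩
  inv_mem' := by
    rintro g ⟨u, hu, c, hc⟩
    refine ⟨u⁻¹, fun p => (hu p).inv, c⁻¹, fun ψ hψ => ?_⟩
    have h1 : ψ = c • act (tensorU u)⁻¹ ψ := by
      rw [← map_smul, ← hc ψ hψ, act_inv_act]
    rw [map_inv]
    by_cases h0 : c = 0
    · have h2 : ψ = 0 := by rw [h1, h0, zero_smul]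
      rw [h2, map_zero, smul_zero]
    · conv_rhs => rw [h1]
      rw [smul_smul, inv_mul_cancel₀ h0, one_smul]

instance scalarGroup_normal (σ : Sec L) : (scalarGroup σ).Normal where
  conj_mem := by
    rintro g ⟨u, hu, c, hc⟩ ⟨h, hh⟩
    obtain ⟨w, hw, hw'⟩ := hh
    refine ⟨w * u * w⁻¹, fun p => ((hw p).mul (hu p)).mul (hw p).inv, c, fun ψ hψ => ?_⟩
    have h1 := act_inv_mem _ _ hw' ψ hψ
    have h2 : act (tensorU w) (act (tensorU w)⁻¹ ψ) = ψ := by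
      have := act_inv_act (tensorU w)⁻¹ ψ
      rwa [inv_inv] at this
    rw [map_mul, map_mul, map_inv, act_mul, act_mul, LinearMap.comp_apply, LinearMap.comp_apply,
      hc _ h1, map_smul, h2]

/-- The group `A(L, σ) / Z(L, σ)` of transversally realisable logical operators, up to scalars.
It carries the quotient topology of the subspace topology of `A(L, σ)` in `SO(3)^P`. -/
abbrev LogicalGroup (σ : Sec L) : Type _ := autGroup σ ⧸ scalarGroup σ

end Automorphisms

/-- A topological group is a compact Lie group if it is compact, Hausdorff and second countable,
and has the structure of a smooth manifold of some finite dimension, compatible with the given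
topology, such that multiplication and inversion are smooth. -/
def IsCompactLieGroup (G : Type*) [Group G] [TopologicalSpace G] : Prop :=
  CompactSpace G ∧ T2Space G ∧ SecondCountableTopology G ∧
    ∃ (n : ℕ) (_ : ChartedSpace (EuclideanSpace ℝ (Fin n)) G), LieGroup (𝓡 n) ∞ G

/-! ### Universal sets of gates and transversal realisations -/

section Gates

/-- The operator on `d` qubits that acts as `u ∈ U(2)` on the qubit `j` and as the identity on
the others. -/
def oneQubitGate {d : ℕ} (j : Fin d) (u : U2) : UnitaryOn (Fin d) := tensorU (Pi.mulSingle j u)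

/-- The unitary scalars on `d` qubits. -/
def phases (d : ℕ) : Set (UnitaryOn (Fin d)) :=
  {U | ∃ c : ℂ, (U : Matrix (Fin d → Fin 2) (Fin d → Fin 2) ℂ) = c • 1}

/-- A set of gates on `d` qubits is universal for the qubit `j` if, up to phases, the group that
it generates contains arbitrarily good approximations of all one-qubit gates on `j`. -/
def IsUniversalOn {d : ℕ} (j : Fin d) (𝒢 : Set (UnitaryOn (Fin d))) : Prop :=
  ∀ u : U2, oneQubitGate j u ∈
    closure ((Subgroup.closure (𝒢 ∪ phases d) : Subgroup (UnitaryOn (Fin d))) :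
      Set (UnitaryOn (Fin d)))

variable {P : Type*} [Fintype P] [DecidableEq P] {L : Submodule (ZMod 2) (P → V)}

/-- Given an identification `φ` of the code with the space of `d` logical qubits, the logical
operator `W` allows approximate transversal realisations: for each `ε > 0` there is a local
unitary operator whose restriction to the code is, up to a phase, `ε`-close in operator norm to
the operator on the code that corresponds to `W`. The local unitary need not preserve the code,
and exact realisations are the special case of distance zero. -/
def IsApproxTransversal (σ : Sec L) {d : ℕ} (φ : code σ ≃ₗ[ℂ] StateSpace (Fin d))
    (W : UnitaryOn (Fin d)) : Prop :=
  ∀ ε : ℝ, 0 < ε → ∃ (u : P → U2) (c : ℂ), ‖c‖ = 1 ∧ ∀ ψ : code σ,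
    ‖act (tensorU u) (ψ : StateSpace P) - c • (φ.symm (act W (φ ψ)) : StateSpace P)‖ ≤ ε * ‖ψ‖

end Gates

end StabCode

end

/-! The sum Π of all stabilizers is a multiple of the projection onto the code, so a local unitary
that preserves the code commutes with Π. Splitting it at a qubit p as A B, with A acting on p and B
on the other qubits, gives A⁻¹ Π A = B Π B⁻¹. The left side changes Pauli operators at p only, the
right side only away from p. Comparing Pauli coefficients (`transfer`) ties the entries of the
rotation at p to products of entries at the other qubits.

Since L has no zero factor, there is v₀ in L of minimal support among the vectors that are nonzero
at p. Three cases arise (`local_type`). If all vectors of L within this support that do not vanish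
at p agree there, the comparison forces every automorphism to preserve one coordinate axis at p.
Otherwise the vectors of L within the support form a plane that projects isomorphically onto V at
every qubit of the support, and isotropy provides a second qubit. If there are three, the absolute
values of corresponding matrix entries lie in [0, 1] and each is at most the product of two others;
so they are 0 or 1 and the rotation is integral. If there are exactly two, they form a Bell pair: an
operator on it, compressed to the space fixed by its stabilizers, is a scalar, so automorphisms can
be made trivial there without changing the logical operator.

Hence each logical operator has a representative that lies at each qubit in an axis stabilizer, in
the group of integral rotations, or in the trivial group. All of these are solvable, and so is the
logical group.

For the Lie structure: integral rotations near 1 are trivial, and those that preserve an axis are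
rotations by small angles. The admissible families of angles form a closed subgroup of ℝ^P, which is
linear near 0. So the logical group is near 1 the image of a vector space under an open
homomorphism, and translated logarithms serve as charts (`exists_lieGroup_of_open_hom`).

Finally, compactness makes approximate realisations exact and the group of realisable operators
closed. If a universal set were realisable, this group would contain all gates on one qubit. But
`diagFlip` lies in every derived subgroup of U(2), so solvability would make the gate `diagFlip` a
scalar, which it is not. -/

noncomputable section

namespace StabCode

/-! ### Closed subgroups of a vector space -/

section ClosedSubgroup

open Filter Topology

variable {E : Type*} [NormedAddCommGroup E] [NormedSpace ℝ E]

/-- The largest linear subspace contained in an additive subgroup of a real vector space. -/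
def linearPart (K : AddSubgroup E) : Submodule ℝ E where
  carrier := {x | ∀ t : ℝ, t • x ∈ K}
  add_mem' {x y} hx hy t := by rw [smul_add]; exact K.add_mem (hx t) (hy t)
  zero_mem' t := by rw [smul_zero]; exact K.zero_mem
  smul_mem' c x hx t := by rw [smul_smul]; exact hx _

theorem linearPart_le {K : AddSubgroup E} {x : E} (hx : x ∈ linearPart K) : x ∈ K := by
  simpa using hx 1

/-- A closed additive subgroup of a finite dimensional real vector space is linear near `0`. -/
theorem exists_ball_inter_subset_linearPart [FiniteDimensional ℝ E] (K : AddSubgroup E)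
    (hK : IsClosed (K : Set E)) :
    ∃ r : ℝ, 0 < r ∧ ∀ x ∈ K, ‖x‖ < r → x ∈ linearPart K := by
  obtain ⟨F, hF⟩ := (linearPart K).exists_isCompl
  have hcompl := hF.symm
  let π : E →L[ℝ] F := LinearMap.toContinuousLinearMap (F.projectionOnto (linearPart K) hcompl)
  have hsub : ∀ x, x - (π x : E) ∈ linearPart K := by
    intro x
    have h : π (x - (π x : E)) = 0 := by
      rw [map_sub, sub_eq_zero]
      exact (Submodule.projectionOnto_apply_left hcompl (π x)).symm
    exact (Submodule.projectionOnto_apply_eq_zero_iff hcompl).mp h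
  -- Modulo the linear part, which lies in `K`, only elements of `K` in the complement `F` matter;
  -- these have to be isolated from `0`.
  suffices hsmall : ∃ r : ℝ, 0 < r ∧ ∀ x ∈ K, x ∈ F → ‖x‖ < r → x = 0 by
    obtain ⟨r, hr, h⟩ := hsmall
    have hcont : Tendsto (fun x => ‖(π x : E)‖) (𝓝 0) (𝓝 0) := by
      have : Continuous fun x => ‖(π x : E)‖ := by fun_prop
      simpa using this.tendsto 0
    obtain ⟨δ, hδ, hball⟩ := Metric.eventually_nhds_iff.mp (hcont.eventually_lt_const hr)
    refine ⟨δ, hδ, fun x hx hxδ => ?_⟩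
    have h0 : (π x : E) = 0 := by
      refine h _ ?_ (π x).2 (hball (by simpa using hxδ))
      have := K.sub_mem hx (linearPart_le (hsub x))
      simpa using this
    have := hsub x
    rwa [h0, sub_zero] at this
  by_contra! hcon
  choose z hzK hzF hz1 hz0 using fun n : ℕ => hcon (1 / ((n : ℝ) + 1)) (by positivity)
  have hzlim : Tendsto (fun n => ‖z n‖) atTop (𝓝 0) :=
    squeeze_zero (fun _ => norm_nonneg _) (fun n => (hz1 n).le)
      tendsto_one_div_add_atTop_nhds_zero_nat
  have hunit : ∀ n, ‖z n‖⁻¹ • z n ∈ Metric.sphere (0 : E) 1 := by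
    intro n
    rw [mem_sphere_zero_iff_norm, norm_smul, norm_inv, norm_norm,
      inv_mul_cancel₀ (norm_ne_zero_iff.mpr (hz0 n))]
  obtain ⟨y, hy, k, hk, hlim⟩ := (isCompact_sphere (0 : E) 1).tendsto_subseq hunit
  have hyF : y ∈ F := F.closed_of_finiteDimensional.mem_of_tendsto hlim
    (Eventually.of_forall fun n => F.smul_mem _ (hzF _))
  -- The integral multiples `⌊t / ‖z‖⌋ • z` of the shrinking vectors `z (k n)` lie in `K` and tend
  -- to `t • y`. So the limit direction `y` lies in both the linear part and `F`, though it has norm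
  -- one.
  have hyL : y ∈ linearPart K := by
    intro t
    have hfl : Tendsto (fun n => (⌊t / ‖z (k n)‖⌋ : ℝ) * ‖z (k n)‖) atTop (𝓝 t) := by
      have hd : Tendsto (fun n => (⌊t / ‖z (k n)‖⌋ : ℝ) * ‖z (k n)‖ - t) atTop (𝓝 0) := by
        refine squeeze_zero_norm (fun n => ?_) (hzlim.comp hk.tendsto_atTop)
        have hpos : 0 < ‖z (k n)‖ := norm_pos_iff.mpr (hz0 _)
        have h1 := Int.floor_le (t / ‖z (k n)‖)
        have h2 := Int.lt_floor_add_one (t / ‖z (k n)‖)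
        rw [le_div_iff₀ hpos] at h1
        rw [div_lt_iff₀ hpos] at h2
        rw [Real.norm_eq_abs, abs_le, Function.comp_apply]
        constructor <;> nlinarith
      simpa using hd.add_const t
    refine hK.mem_of_tendsto (hfl.smul hlim) (Eventually.of_forall fun n => ?_)
    have : ((⌊t / ‖z (k n)‖⌋ : ℝ) * ‖z (k n)‖) • (‖z (k n)‖⁻¹ • z (k n)) =
        ⌊t / ‖z (k n)‖⌋ • z (k n) := by
      rw [smul_smul, mul_assoc, mul_inv_cancel₀ (norm_ne_zero_iff.mpr (hz0 _)), mul_one,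
        Int.cast_smul_eq_zsmul]
    simp only [Function.comp_apply]
    rw [this]
    exact K.zsmul_mem (hzK _) _
  have : y = 0 := by
    have := (Submodule.disjoint_def.mp hF.disjoint) y hyL hyF
    exact this
  rw [this] at hy
  simp at hy

end ClosedSubgroup

/-! ### Locally additive maps -/

section LocalHom

open Filter Topology

variable {E : Type*} [NormedAddCommGroup E] [NormedSpace ℝ E]
variable {E' : Type*} [NormedAddCommGroup E'] [NormedSpace ℝ E']

/-- A map that is additive near `0` and continuous at `0` coincides with a continuous linear map
near `0`. -/
theorem exists_continuousLinearMap_eq_of_local_additive (χ : E → E') {δ : ℝ} (hδ : 0 < δ)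
    (hadd : ∀ x y, ‖x‖ < δ → ‖y‖ < δ → ‖x + y‖ < δ → χ (x + y) = χ x + χ y)
    (hcont : ContinuousAt χ 0) :
    ∃ T : E →L[ℝ] E', ∀ x, ‖x‖ < δ → χ x = T x := by
  have hzero : χ 0 = 0 := by
    have := hadd 0 0 (by simpa) (by simpa) (by simpa)
    simpa using this
  have hmul : ∀ (k : ℕ) (y : E), ‖(k : ℝ) • y‖ < δ → χ ((k : ℝ) • y) = (k : ℝ) • χ y := by
    intro k
    induction k with
    | zero => intro y _; simp [hzero]
    | succ k ih =>
      intro y hy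
      rw [norm_smul, Real.norm_natCast] at hy
      push_cast at hy
      have hk0 : (0 : ℝ) ≤ k := Nat.cast_nonneg k
      have hy0 := norm_nonneg y
      have hk : ‖(k : ℝ) • y‖ < δ := by
        rw [norm_smul, Real.norm_natCast]; nlinarith
      have h1 : ‖y‖ < δ := by nlinarith
      have h2 : ((k + 1 : ℕ) : ℝ) • y = (k : ℝ) • y + y := by push_cast; rw [add_smul, one_smul]
      have h3 : ‖(k : ℝ) • y + y‖ < δ := by
        rw [← h2, norm_smul, Real.norm_natCast]; push_cast; exact hy
      rw [h2, hadd _ _ hk h1 h3, ih y hk]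
      push_cast
      rw [add_smul, one_smul]
  have hscale : ∀ x : E, ∃ N : ℕ, 0 < N ∧ ‖x‖ < N * δ := by
    intro x
    obtain ⟨N, hN⟩ := exists_nat_gt (‖x‖ / δ)
    refine ⟨N + 1, N.succ_pos, ?_⟩
    rw [div_lt_iff₀ hδ] at hN
    push_cast
    nlinarith
  have hsmall : ∀ (N : ℕ) (x : E), 0 < N → ‖x‖ < N * δ → ‖(N : ℝ)⁻¹ • x‖ < δ := by
    intro N x hN hx
    have : (0 : ℝ) < N := Nat.cast_pos.mpr hN
    rw [norm_smul, norm_inv, Real.norm_natCast, inv_mul_lt_iff₀ this]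
    exact hx
  have hrefine : ∀ (N M : ℕ) (x : E), 0 < N → 0 < M → ‖x‖ < N * δ →
      (N : ℝ) • χ ((N : ℝ)⁻¹ • x) = ((N : ℝ) * M) • χ (((N : ℝ) * M)⁻¹ • x) := by
    intro N M x hN hM hx
    have hM' : (M : ℝ) ≠ 0 := Nat.cast_ne_zero.mpr hM.ne'
    have heq : (M : ℝ) • (((N : ℝ) * M)⁻¹ • x) = (N : ℝ)⁻¹ • x := by
      rw [smul_smul, mul_inv, mul_comm (N : ℝ)⁻¹, ← mul_assoc, mul_inv_cancel₀ hM', one_mul]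
    have := hmul M (((N : ℝ) * M)⁻¹ • x) (by rw [heq]; exact hsmall N x hN hx)
    rw [heq] at this
    rw [this, smul_smul]
  have hindep : ∀ (N M : ℕ) (x : E), 0 < N → 0 < M → ‖x‖ < N * δ → ‖x‖ < M * δ →
      (N : ℝ) • χ ((N : ℝ)⁻¹ • x) = (M : ℝ) • χ ((M : ℝ)⁻¹ • x) := by
    intro N M x hN hM hxN hxM
    rw [hrefine N M x hN hM hxN, hrefine M N x hM hN hxM, mul_comm (N : ℝ)]
  choose N hN hxN using hscale
  -- The value at `x` is scaled up from a point `x / N` where `χ` is additive; by `hindep` every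
  -- sufficiently large `N` gives the same result.
  let T : E → E' := fun x => (N x : ℝ) • χ ((N x : ℝ)⁻¹ • x)
  have hT : ∀ (M : ℕ) (x : E), 0 < M → ‖x‖ < M * δ → T x = (M : ℝ) • χ ((M : ℝ)⁻¹ • x) :=
    fun M x hM hx => hindep _ _ x (hN x) hM (hxN x) hx
  have hTχ : ∀ x, ‖x‖ < δ → T x = χ x := by
    intro x hx
    simpa using hT 1 x one_pos (by simpa using hx)
  have hTadd : ∀ x y, T (x + y) = T x + T y := by
    intro x y
    let M := N x + N y + N (x + y)
    have hle : ∀ n : ℕ, n ≤ M → (n : ℝ) * δ ≤ M * δ := fun n hn => by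
      have : (n : ℝ) ≤ M := Nat.cast_le.mpr hn
      nlinarith
    have hM : 0 < M := by have := hN x; omega
    have hx : ‖x‖ < M * δ := (hxN x).trans_le (hle _ (by omega))
    have hy : ‖y‖ < M * δ := (hxN y).trans_le (hle _ (by omega))
    have hxy : ‖x + y‖ < M * δ := (hxN (x + y)).trans_le (hle _ (by omega))
    rw [hT M x hM hx, hT M y hM hy, hT M _ hM hxy, smul_add, hadd _ _ (hsmall M x hM hx)
      (hsmall M y hM hy) (by rw [← smul_add]; exact hsmall M _ hM hxy), smul_add]
  let T' : E →+ E' := AddMonoidHom.mk' T hTadd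
  have hT'cont : Continuous T' := by
    refine continuous_of_continuousAt_zero T' ?_
    have hev : T' =ᶠ[𝓝 0] χ := by
      filter_upwards [Metric.ball_mem_nhds (0 : E) hδ] with x hx
      exact hTχ x (by simpa using hx)
    exact hcont.congr hev.symm
  exact ⟨T'.toRealLinearMap hT'cont, fun x hx => (hTχ x hx).symm⟩

end LocalHom

/-! ### Lie structure from an open homomorphism -/

section LocallyAbelianLie

open Filter Topology

/-- A continuous homomorphism from the additive group of a normed space to a topological group
which is open and injective near `0`. -/
structure LocalExp (E G : Type*) [NormedAddCommGroup E] [Group G] [TopologicalSpace G] where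
  /-- The homomorphism. -/
  toFun : E → G
  map_add : ∀ x y, toFun (x + y) = toFun x * toFun y
  continuous_toFun : Continuous toFun
  isOpenMap_toFun : IsOpenMap toFun
  /-- The radius of a ball on which the homomorphism is injective. -/
  radius : ℝ
  radius_pos : 0 < radius
  injOn : Set.InjOn toFun (Metric.ball 0 radius)

namespace LocalExp

variable {E G : Type*} [NormedAddCommGroup E] [Group G] [TopologicalSpace G] (e : LocalExp E G)

theorem map_zero : e.toFun 0 = 1 := by
  have := e.map_add 0 0
  simpa using this

theorem map_neg (x : E) : e.toFun (-x) = (e.toFun x)⁻¹ := by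
  rw [eq_inv_iff_mul_eq_one, ← e.map_add, neg_add_cancel, e.map_zero]

/-- The local inverse of the exponential map. -/
def log : OpenPartialHomeomorph G E :=
  (OpenPartialHomeomorph.ofContinuousOpen (e.injOn.toPartialEquiv)
    e.continuous_toFun.continuousOn e.isOpenMap_toFun Metric.isOpen_ball).symm

theorem log_target : e.log.target = Metric.ball 0 e.radius := rfl

theorem log_source : e.log.source = e.toFun '' Metric.ball 0 e.radius := rfl

theorem log_toFun {x : E} (hx : ‖x‖ < e.radius) : e.log (e.toFun x) = x := by
  have : x ∈ e.log.target := by rw [log_target]; simpa using hx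
  exact e.log.right_inv this

theorem toFun_mem_source {x : E} (hx : ‖x‖ < e.radius) : e.toFun x ∈ e.log.source := by
  rw [log_source]; exact ⟨x, by simpa using hx, rfl⟩

theorem toFun_log {a : G} (ha : a ∈ e.log.source) : e.toFun (e.log a) = a := e.log.left_inv ha

theorem norm_log_lt {a : G} (ha : a ∈ e.log.source) : ‖e.log a‖ < e.radius := by
  have := e.log.map_source ha
  rw [log_target] at this
  simpa using this

theorem one_mem_source : (1 : G) ∈ e.log.source := by
  rw [← e.map_zero]; exact e.toFun_mem_source (by simpa using e.radius_pos)

theorem log_one : e.log (1 : G) = 0 := by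
  rw [← e.map_zero]; exact e.log_toFun (by simpa using e.radius_pos)

variable [IsTopologicalGroup G]

/-- The translate to `g` of the logarithmic chart. -/
def chart (g : G) : OpenPartialHomeomorph G E :=
  (Homeomorph.mulLeft g⁻¹).transOpenPartialHomeomorph e.log

theorem chart_apply (g a : G) : e.chart g a = e.log (g⁻¹ * a) := rfl

theorem mem_chart_source {g a : G} : a ∈ (e.chart g).source ↔ g⁻¹ * a ∈ e.log.source := Iff.rfl

theorem chart_symm_apply (g : G) (x : E) : (e.chart g).symm x = g * e.toFun x := by
  change g⁻¹⁻¹ * e.toFun x = _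
  rw [inv_inv]

/-- The atlas of all translates of the logarithmic chart. -/
@[reducible] def chartedSpace : ChartedSpace E G where
  atlas := Set.range e.chart
  chartAt := e.chart
  mem_chart_source g := by rw [mem_chart_source, inv_mul_cancel]; exact e.one_mem_source
  chart_mem_atlas g := ⟨g, rfl⟩

variable [NormedSpace ℝ E]

/-- In logarithmic coordinates conjugation is additive near `0` and continuous at `0`, hence linear
near `0`. This makes the group operations smooth although `G` need not be commutative. -/
theorem exists_conj_eq (h : G) :
    ∃ T : E →L[ℝ] E, ∀ᶠ x in 𝓝 0, h⁻¹ * e.toFun x * h = e.toFun (T x) := by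
  let c : E → G := fun x => h⁻¹ * e.toFun x * h
  have hc : Continuous c := by
    have := e.continuous_toFun
    fun_prop
  have hc0 : c 0 = 1 := by simp [c, e.map_zero]
  have hcadd : ∀ x y, c (x + y) = c x * c y := by
    intro x y; simp only [c, e.map_add]; group
  have hsrc : ∀ᶠ x in 𝓝 0, c x ∈ e.log.source :=
    hc.continuousAt.eventually (by rw [hc0]; exact e.log.open_source.mem_nhds e.one_mem_source)
  have hlogc : ContinuousAt (fun x => e.log (c x)) 0 := by
    refine ContinuousAt.comp (g := e.log) ?_ hc.continuousAt
    rw [hc0]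
    exact e.log.continuousAt e.one_mem_source
  have hlog0 : e.log (c 0) = 0 := by rw [hc0, e.log_one]
  -- Half the radius, so that the sum of two such logarithms stays in the ball where `e` is
  -- injective.
  have hsmall : ∀ᶠ x in 𝓝 0, ‖e.log (c x)‖ < e.radius / 2 := by
    have := hlogc.norm.eventually_lt_const (u := e.radius / 2)
      (by simpa [hlog0] using half_pos e.radius_pos)
    exact this
  obtain ⟨δ, hδ, hball⟩ := Metric.eventually_nhds_iff.mp (hsrc.and hsmall)
  have hball' : ∀ x : E, ‖x‖ < δ → c x ∈ e.log.source ∧ ‖e.log (c x)‖ < e.radius / 2 :=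
    fun x hx => hball (by simpa using hx)
  obtain ⟨T, hT⟩ := exists_continuousLinearMap_eq_of_local_additive (fun x => e.log (c x)) hδ
    (fun x y hx hy _ => by
      have h1 := hball' x hx
      have h2 := hball' y hy
      have h3 : ‖e.log (c x) + e.log (c y)‖ < e.radius :=
        (norm_add_le _ _).trans_lt (by linarith [h1.2, h2.2])
      change e.log (c (x + y)) = _
      rw [hcadd, ← e.toFun_log h1.1, ← e.toFun_log h2.1, ← e.map_add, e.log_toFun h3,
        e.toFun_log h1.1, e.toFun_log h2.1]) hlogc
  refine ⟨T, ?_⟩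
  filter_upwards [Metric.ball_mem_nhds (0 : E) hδ] with x hx
  have hx' : ‖x‖ < δ := by simpa using hx
  rw [← hT x hx', e.toFun_log (hball' x hx').1]

/-- Near each point `x₀` of an overlap the change of charts is the translation `x ↦ y₀ + (x - x₀)`,
because charts are left translates of one logarithm. -/
theorem isManifold : @IsManifold ℝ _ E _ _ E _ 𝓘(ℝ, E) ∞ G _ e.chartedSpace := by
  let _ := e.chartedSpace
  refine isManifold_of_contDiffOn _ _ _ ?_
  rintro _ _ ⟨g, rfl⟩ ⟨h, rfl⟩
  intro x₀ hx₀
  simp only [modelWithCornersSelf_coe, modelWithCornersSelf_coe_symm, Set.range_id,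
    Set.inter_univ, Set.preimage_id_eq, id_eq, OpenPartialHomeomorph.trans_source,
    OpenPartialHomeomorph.symm_source, Set.mem_inter_iff, Set.mem_preimage] at hx₀
  obtain ⟨-, hsrc⟩ := hx₀
  rw [chart_symm_apply, mem_chart_source] at hsrc
  set y₀ := e.log (h⁻¹ * (g * e.toFun x₀)) with hy₀
  have hy : e.toFun y₀ = h⁻¹ * (g * e.toFun x₀) := e.toFun_log hsrc
  have hlin : ContDiffAt ℝ ∞ (fun x : E => y₀ + (x - x₀)) x₀ := by fun_prop
  refine (hlin.congr_of_eventuallyEq ?_).contDiffWithinAt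
  have hnear : ∀ᶠ x in 𝓝 x₀, ‖y₀ + (x - x₀)‖ < e.radius := by
    have hcont : ContinuousAt (fun x : E => ‖y₀ + (x - x₀)‖) x₀ := by fun_prop
    exact hcont.eventually_lt_const (by simpa using e.norm_log_lt hsrc)
  filter_upwards [hnear] with x hx
  simp only [modelWithCornersSelf_coe, modelWithCornersSelf_coe_symm, Function.comp_apply, id_eq,
    OpenPartialHomeomorph.coe_trans]
  rw [chart_symm_apply, chart_apply]
  have : h⁻¹ * (g * e.toFun x) = e.toFun (y₀ + (x - x₀)) := by
    rw [e.map_add, hy, mul_assoc, mul_assoc, ← e.map_add, add_sub_cancel]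
  rw [this, e.log_toFun hx]

/-- In the charts at `g`, `h` and `g * h` the product reads `(x, y) ↦ T x + y`, where `T` is the
linear form of `a ↦ h⁻¹ * a * h`. Inversion reads `x ↦ -T x` with `T` taken for `g⁻¹` in place of
`h`. -/
theorem lieGroup : @LieGroup ℝ _ E _ E _ _ 𝓘(ℝ, E) ∞ G _ _ e.chartedSpace := by
  let _ := e.chartedSpace
  have := e.isManifold
  have hnear : ∀ {X : Type _} [TopologicalSpace X] (f : X → E) (x : X), ContinuousAt f x →
      f x = 0 → ∀ᶠ y in 𝓝 x, ‖f y‖ < e.radius := by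
    intro X _ f x hf h0
    exact hf.norm.eventually_lt_const (by simpa [h0] using e.radius_pos)
  have hchart : ∀ g : G, chartAt E g = e.chart g := fun g => rfl
  have hchart0 : ∀ g : G, e.chart g g = 0 := fun g => by
    rw [chart_apply, inv_mul_cancel, e.log_one]
  refine { contMDiff_mul := ?_, contMDiff_inv := ?_ }
  · rintro ⟨g, h⟩
    rw [contMDiffAt_iff]
    refine ⟨continuous_mul.continuousAt, ?_⟩
    obtain ⟨T, hT⟩ := e.exists_conj_eq h
    have hlin : ContDiffAt ℝ ∞ (fun z : E × E => T z.1 + z.2) 0 := by fun_prop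
    have hpt : (extChartAt (𝓘(ℝ, E).prod 𝓘(ℝ, E)) (g, h)) (g, h) = (0 : E × E) := by
      simp [extChartAt, hchart, hchart0, OpenPartialHomeomorph.extend]
    rw [hpt]
    refine (hlin.congr_of_eventuallyEq ?_).contDiffWithinAt
    have h1 : ∀ᶠ z : E × E in 𝓝 0, h⁻¹ * e.toFun z.1 * h = e.toFun (T z.1) :=
      (continuous_fst.tendsto' (0 : E × E) 0 rfl).eventually hT
    have h2 := hnear (fun z : E × E => T z.1 + z.2) 0 hlin.continuousAt (by simp)
    filter_upwards [h1, h2] with z hz1 hz2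
    change e.log ((g * h)⁻¹ * ((e.chart g).symm z.1 * (e.chart h).symm z.2)) = _
    rw [chart_symm_apply, chart_symm_apply]
    have : (g * h)⁻¹ * (g * e.toFun z.1 * (h * e.toFun z.2)) = e.toFun (T z.1 + z.2) := by
      rw [e.map_add, ← hz1]; group
    rw [this, e.log_toFun hz2]
  · intro g
    rw [contMDiffAt_iff]
    refine ⟨continuous_inv.continuousAt, ?_⟩
    obtain ⟨T, hT⟩ := e.exists_conj_eq g⁻¹
    have hlin : ContDiffAt ℝ ∞ (fun z : E => -T z) 0 := by fun_prop
    have hpt : (extChartAt 𝓘(ℝ, E) g) g = (0 : E) := by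
      simp [extChartAt, hchart, hchart0, OpenPartialHomeomorph.extend]
    rw [hpt]
    refine (hlin.congr_of_eventuallyEq ?_).contDiffWithinAt
    have h2 := hnear (fun z : E => -T z) 0 hlin.continuousAt (by simp)
    filter_upwards [hT, h2] with z hz1 hz2
    simp only [extChartAt, OpenPartialHomeomorph.extend, hchart, Function.comp_apply,
      mfld_simps, chart_apply, chart_symm_apply]
    have : g⁻¹⁻¹ * (g * e.toFun z)⁻¹ = e.toFun (-T z) := by
      rw [e.map_neg, ← hz1]; group
    rw [this, e.log_toFun hz2]

end LocalExp

/-- A Hausdorff group that is locally the image of a vector space under an open homomorphism is a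
Lie group. -/
theorem exists_lieGroup_of_open_hom {E G : Type*} [NormedAddCommGroup E] [NormedSpace ℝ E]
    [FiniteDimensional ℝ E] [Group G] [TopologicalSpace G] [IsTopologicalGroup G] [T2Space G]
    (f : E → G) (hadd : ∀ x y, f (x + y) = f x * f y) (hcont : Continuous f)
    (hopen : ∀ U ∈ 𝓝 (0 : E), f '' U ∈ 𝓝 (1 : G)) :
    ∃ (n : ℕ) (_ : ChartedSpace (EuclideanSpace ℝ (Fin n)) G), LieGroup (𝓡 n) ∞ G := by
  have hf0 : f 0 = 1 := by
    have := hadd 0 0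
    simpa using this
  have hneg : ∀ x, f (-x) = (f x)⁻¹ := fun x => by
    rw [eq_inv_iff_mul_eq_one, ← hadd, neg_add_cancel, hf0]
  let K : AddSubgroup E :=
    { carrier := {x | f x = 1}
      add_mem' := fun {x y} hx hy => by
        simp only [Set.mem_ofPred_eq] at *; rw [hadd, hx, hy, one_mul]
      zero_mem' := hf0
      neg_mem' := fun {x} hx => by
        simp only [Set.mem_ofPred_eq] at *; rw [hneg, hx, inv_one] }
  obtain ⟨r, hr, hball⟩ := exists_ball_inter_subset_linearPart K
    (isClosed_singleton.preimage hcont : IsClosed (f ⁻¹' {1}))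
  -- `f` may have a kernel of positive dimension. It factors through the projection to `F`, where
  -- the kernel is trivial near `0`.
  obtain ⟨F, hF⟩ := (linearPart K).exists_isCompl
  let π : E →L[ℝ] F := LinearMap.toContinuousLinearMap (F.projectionOnto (linearPart K) hF.symm)
  have hπ : ∀ x, f x = f (π x) := by
    intro x
    have h : π (x - (π x : E)) = 0 := by
      rw [map_sub, sub_eq_zero]
      exact (Submodule.projectionOnto_apply_left hF.symm (π x)).symm
    have hmem := (Submodule.projectionOnto_apply_eq_zero_iff hF.symm).mp h
    have h1 : f (x - (π x : E)) = 1 := linearPart_le hmem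
    have h2 := hadd (x - (π x : E)) (π x)
    rwa [sub_add_cancel, h1, one_mul] at h2
  let ι : EuclideanSpace ℝ (Fin (Module.finrank ℝ F)) ≃L[ℝ] F :=
    ContinuousLinearEquiv.ofFinrankEq (by simp)
  let i : EuclideanSpace ℝ (Fin (Module.finrank ℝ F)) → E := fun x => (ι x : E)
  have hi : Continuous i := by fun_prop
  have hi0 : i 0 = 0 := by simp [i]
  have hiadd : ∀ x y, i (x + y) = i x + i y := fun x y => by simp [i]
  have hisub : ∀ x y, i (x - y) = i x - i y := fun x y => by simp [i]
  have hopen0 : ∀ U ∈ 𝓝 (0 : EuclideanSpace ℝ (Fin (Module.finrank ℝ F))),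
      (fun x => f (i x)) '' U ∈ 𝓝 (1 : G) := by
    intro U hU
    let V : Set E := (fun x => ι.symm (π x)) ⁻¹' U
    have hV : V ∈ 𝓝 (0 : E) := by
      have hc : Continuous fun x => ι.symm (π x) := by fun_prop
      refine hc.continuousAt.preimage_mem_nhds ?_
      simpa using hU
    refine mem_of_superset (hopen V hV) ?_
    rintro _ ⟨x, hx, rfl⟩
    refine ⟨ι.symm (π x), hx, ?_⟩
    simp only [i, ContinuousLinearEquiv.apply_symm_apply]
    exact (hπ x).symm
  have hisOpen : IsOpenMap fun x => f (i x) := by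
    rw [isOpenMap_iff_nhds_le]
    intro x U hU
    rw [mem_map] at hU
    have h1 : (fun y => x + y) ⁻¹' ((fun x => f (i x)) ⁻¹' U) ∈
        𝓝 (0 : EuclideanSpace ℝ (Fin (Module.finrank ℝ F))) := by
      refine (continuous_const.add continuous_id).continuousAt.preimage_mem_nhds ?_
      simpa using hU
    have h2 := hopen0 _ h1
    have h3 : (fun a => (f (i x))⁻¹ * a) ⁻¹' _ ∈ 𝓝 (f (i x)) :=
      (continuous_const.mul continuous_id).continuousAt.preimage_mem_nhds (by simpa using h2)
    refine mem_of_superset h3 ?_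
    rintro a ⟨y, hy, hya⟩
    simp only [Set.mem_preimage] at hy
    rw [hiadd, hadd] at hy
    simp only at hya
    rw [hya] at hy
    simpa using hy
  have hsmall : ∃ ρ > 0, ∀ x, ‖x‖ < ρ → ‖i x‖ < r / 2 := by
    have hc : ContinuousAt (fun x => ‖i x‖) 0 := by fun_prop
    have := hc.eventually_lt_const (u := r / 2) (by simpa [hi0] using half_pos hr)
    obtain ⟨ρ, hρ, h⟩ := Metric.eventually_nhds_iff.mp this
    exact ⟨ρ, hρ, fun x hx => h (by simpa using hx)⟩
  obtain ⟨ρ, hρ, hρ'⟩ := hsmall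
  let e : LocalExp (EuclideanSpace ℝ (Fin (Module.finrank ℝ F))) G :=
    { toFun := fun x => f (i x)
      map_add := fun x y => by rw [hiadd, hadd]
      continuous_toFun := hcont.comp hi
      isOpenMap_toFun := hisOpen
      radius := ρ
      radius_pos := hρ
      injOn := by
        intro x hx y hy hxy
        have hxy' : f (i x) = f (i y) := hxy
        have h1 : f (i (x - y)) = 1 := by
          rw [hisub, sub_eq_add_neg, hadd, hneg, hxy', mul_inv_cancel]
        have h2 : ‖i (x - y)‖ < r := by
          rw [hisub]
          have h3 := hρ' x (by simpa using hx)
          have h4 := hρ' y (by simpa using hy)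
          exact (norm_sub_le _ _).trans_lt (by linarith)
        have h3 := hball _ h1 h2
        have h4 : i (x - y) = 0 := (Submodule.disjoint_def.mp hF.disjoint) _ h3 (ι (x - y)).2
        have h5 : ι (x - y) = 0 := Subtype.ext h4
        rw [map_eq_zero_iff ι ι.injective, sub_eq_zero] at h5
        exact h5 }
  exact ⟨_, e.chartedSpace, e.lieGroup⟩

end LocallyAbelianLie

/-! ### Solvable subgroups of SO(3) and their neighbourhoods of the identity -/

section Rotations

open Topology Filter

instance compactSpace_unitaryGroup {n : Type*} [Fintype n] [DecidableEq n] :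
    CompactSpace (Matrix.unitaryGroup n ℂ) := by
  refine isCompact_iff_compactSpace.mp ?_
  have hsub : (Matrix.unitaryGroup n ℂ : Set (Matrix n n ℂ)) ⊆
      Set.pi Set.univ fun _ => Set.pi Set.univ fun _ => Metric.closedBall 0 1 := by
    intro U hU a _ b _
    simpa using entry_norm_bound_of_unitary hU a b
  have hcpt : IsCompact (Set.pi Set.univ fun _ : n => Set.pi Set.univ fun _ : n =>
      Metric.closedBall (0 : ℂ) 1) :=
    isCompact_univ_pi fun _ => isCompact_univ_pi fun _ => isCompact_closedBall 0 1
  exact IsCompact.of_isClosed_subset hcpt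
    (isClosed_unitary : IsClosed (unitary (Matrix n n ℂ) : Set (Matrix n n ℂ))) hsub

theorem SO3.mul_transpose (g : SO3) :
    (g : Matrix (Fin 3) (Fin 3) ℝ) * (g : Matrix (Fin 3) (Fin 3) ℝ).transpose = 1 := by
  have := Matrix.mem_unitaryGroup_iff.mp (Matrix.mem_specialUnitaryGroup_iff.mp g.2).1
  rwa [Matrix.star_eq_conjTranspose, Matrix.conjTranspose_eq_transpose_of_trivial] at this

theorem SO3.transpose_mul (g : SO3) :
    (g : Matrix (Fin 3) (Fin 3) ℝ).transpose * (g : Matrix (Fin 3) (Fin 3) ℝ) = 1 := by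
  have := Matrix.mem_unitaryGroup_iff'.mp (Matrix.mem_specialUnitaryGroup_iff.mp g.2).1
  rwa [Matrix.star_eq_conjTranspose, Matrix.conjTranspose_eq_transpose_of_trivial] at this

theorem SO3.det_eq (g : SO3) : (g : Matrix (Fin 3) (Fin 3) ℝ).det = 1 :=
  (Matrix.mem_specialUnitaryGroup_iff.mp g.2).2

theorem SO3.mk_mem {M : Matrix (Fin 3) (Fin 3) ℝ} (h : M * M.transpose = 1) (hdet : M.det = 1) :
    M ∈ Matrix.specialOrthogonalGroup (Fin 3) ℝ := by
  refine Matrix.mem_specialUnitaryGroup_iff.mpr ⟨Matrix.mem_unitaryGroup_iff.mpr ?_, hdet⟩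
  rwa [Matrix.star_eq_conjTranspose, Matrix.conjTranspose_eq_transpose_of_trivial]

theorem SO3.coe_inv (g : SO3) :
    ((g⁻¹ : SO3) : Matrix (Fin 3) (Fin 3) ℝ) = (g : Matrix (Fin 3) (Fin 3) ℝ).transpose := by
  rw [← Matrix.conjTranspose_eq_transpose_of_trivial]
  rfl

theorem SO3.row_dot (g : SO3) (a b : Fin 3) :
    ∑ k, g.1 a k * g.1 b k = if a = b then 1 else 0 := by
  have := congrFun (congrFun g.mul_transpose a) b
  simpa [Matrix.mul_apply, Matrix.one_apply] using this

theorem SO3.col_dot (g : SO3) (a b : Fin 3) :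
    ∑ k, g.1 k a * g.1 k b = if a = b then 1 else 0 := by
  have := congrFun (congrFun g.transpose_mul a) b
  simpa [Matrix.mul_apply, Matrix.one_apply] using this

instance compactSpace_SO3 : CompactSpace SO3 := by
  refine isCompact_iff_compactSpace.mp ?_
  have hsub : (Matrix.specialOrthogonalGroup (Fin 3) ℝ : Set (Matrix (Fin 3) (Fin 3) ℝ)) ⊆
      Set.pi Set.univ fun _ => Set.pi Set.univ fun _ => Metric.closedBall 0 1 := by
    intro U hU a _ b _
    simpa using entry_norm_bound_of_unitary (Matrix.mem_specialUnitaryGroup_iff.mp hU).1 a b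
  have hcpt : IsCompact (Set.pi Set.univ fun _ : Fin 3 => Set.pi Set.univ fun _ : Fin 3 =>
      Metric.closedBall (0 : ℝ) 1) :=
    isCompact_univ_pi fun _ => isCompact_univ_pi fun _ => isCompact_closedBall 0 1
  refine IsCompact.of_isClosed_subset hcpt ?_ hsub
  have heq : (Matrix.specialOrthogonalGroup (Fin 3) ℝ : Set (Matrix (Fin 3) (Fin 3) ℝ)) =
      {M | M * M.transpose = 1} ∩ {M | M.det = 1} := by
    ext M
    refine ⟨fun h => ⟨SO3.mul_transpose ⟨M, h⟩, SO3.det_eq ⟨M, h⟩⟩, fun h => SO3.mk_mem h.1 h.2⟩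
  rw [heq]
  exact (isClosed_eq (by fun_prop) continuous_const).inter
    (isClosed_eq (by fun_prop) continuous_const)

instance isTopologicalGroup_SO3 : IsTopologicalGroup SO3 where
  continuous_inv := by
    refine Continuous.subtype_mk ?_ _
    exact continuous_star.comp continuous_subtype_val

instance secondCountableTopology_SO3 : SecondCountableTopology SO3 := by
  have : SecondCountableTopology (Matrix (Fin 3) (Fin 3) ℝ) :=
    inferInstanceAs (SecondCountableTopology (Fin 3 → Fin 3 → ℝ))
  exact Topology.IsEmbedding.subtypeVal.secondCountableTopology

/-- The matrix that fixes the `i`-th coordinate and acts as `!![c, -s; s, c]` on the two others,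
taken in cyclic order. -/
def rotMat (i : Fin 3) (c s : ℝ) : Matrix (Fin 3) (Fin 3) ℝ := fun a b =>
  if a = i then (if b = i then 1 else 0) else if b = i then 0 else
    if a = b then c else if a = i + 1 then -s else s

theorem rotMat_mul (i : Fin 3) (c s c' s' : ℝ) :
    rotMat i c s * rotMat i c' s' = rotMat i (c * c' - s * s') (s * c' + c * s') := by
  ext a b
  rw [Matrix.mul_apply, Fin.sum_univ_three]
  fin_cases i <;> fin_cases a <;> fin_cases b <;> simp [rotMat] <;> ring

theorem rotMat_transpose (i : Fin 3) (c s : ℝ) :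
    (rotMat i c s).transpose = rotMat i c (-s) := by
  ext a b
  fin_cases i <;> fin_cases a <;> fin_cases b <;> simp [rotMat]

theorem rotMat_one_zero (i : Fin 3) : rotMat i 1 0 = 1 := by
  ext a b
  fin_cases i <;> fin_cases a <;> fin_cases b <;> simp [rotMat]

theorem rotMat_det (i : Fin 3) (c s : ℝ) : (rotMat i c s).det = c ^ 2 + s ^ 2 := by
  rw [Matrix.det_fin_three]
  fin_cases i <;> simp [rotMat] <;> ring

/-- The rotation by the angle `θ` about the `i`-th coordinate axis. -/
def rot (i : Fin 3) (θ : ℝ) : SO3 :=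
  ⟨rotMat i (Real.cos θ) (Real.sin θ), SO3.mk_mem
    (by
      rw [rotMat_transpose, rotMat_mul, ← rotMat_one_zero i]
      congr 1
      · nlinarith [Real.sin_sq_add_cos_sq θ]
      · ring)
    (by rw [rotMat_det, Real.cos_sq_add_sin_sq])⟩

theorem rot_add (i : Fin 3) (θ η : ℝ) : rot i (θ + η) = rot i θ * rot i η := by
  apply Subtype.ext
  change rotMat _ _ _ = rotMat _ _ _ * rotMat _ _ _
  rw [rotMat_mul, Real.cos_add, Real.sin_add]

theorem rot_zero (i : Fin 3) : rot i 0 = 1 := by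
  apply Subtype.ext
  change rotMat _ _ _ = 1
  rw [Real.cos_zero, Real.sin_zero, rotMat_one_zero]

theorem continuous_rot (i : Fin 3) : Continuous (rot i) := by
  refine Continuous.subtype_mk ?_ _
  refine continuous_matrix fun a b => ?_
  unfold rotMat
  split_ifs <;> fun_prop

/-- The stabilizer of the `i`-th coordinate axis. -/
def axisStab (i : Fin 3) : Subgroup SO3 where
  carrier := {g | ∀ j, j ≠ i → g.1 i j = 0}
  one_mem' j hj := Matrix.one_apply_ne hj.symm
  mul_mem' {g h} hg hh j hj := by
    rw [Submonoid.coe_mul, Matrix.mul_apply]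
    refine Finset.sum_eq_zero fun k _ => ?_
    by_cases hk : k = i
    · rw [hk, hh j hj, mul_zero]
    · rw [hg k hk, zero_mul]
  inv_mem' {g} hg j hj := by
    -- Row `i` has unit length, so `g i i = ±1`; column `i` also has unit length, which leaves no
    -- room for other entries.
    have h1 : g.1 i i * g.1 i i = 1 := by
      have := g.row_dot i i
      rw [if_pos rfl, Finset.sum_eq_single i (fun k _ hk => by rw [hg k hk, zero_mul])
        (by simp)] at this
      exact this
    have h2 := g.col_dot i i
    rw [if_pos rfl, ← Finset.add_sum_erase _ _ (Finset.mem_univ i), h1] at h2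
    have h3 : ∑ k ∈ Finset.univ.erase i, g.1 k i * g.1 k i = 0 := by linarith
    rw [Finset.sum_eq_zero_iff_of_nonneg fun k _ => mul_self_nonneg _] at h3
    rw [SO3.coe_inv, Matrix.transpose_apply]
    exact mul_self_eq_zero.mp (h3 j (by simpa using hj))

theorem axisStab_diag_mul {i : Fin 3} {g : SO3} (hg : g ∈ axisStab i) (h : SO3) :
    (g * h).1 i i = g.1 i i * h.1 i i := by
  rw [Submonoid.coe_mul, Matrix.mul_apply]
  exact Finset.sum_eq_single i (fun k _ hk => by rw [hg k hk, zero_mul]) (by simp)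

theorem axisStab_diag_sq {i : Fin 3} {g : SO3} (hg : g ∈ axisStab i) :
    g.1 i i * g.1 i i = 1 := by
  have := g.row_dot i i
  rw [if_pos rfl, Finset.sum_eq_single i (fun k _ hk => by rw [hg k hk, zero_mul])
    (by simp)] at this
  exact this

theorem sum_cyclic (i : Fin 3) (f : Fin 3 → ℝ) : ∑ k, f k = f i + f (i + 1) + f (i + 2) := by
  rw [Fin.sum_univ_three]
  fin_cases i <;> simp <;> ring

theorem det_cyclic (i : Fin 3) (M : Matrix (Fin 3) (Fin 3) ℝ) :
    M.det = M i i * (M (i + 1) (i + 1) * M (i + 2) (i + 2) - M (i + 1) (i + 2) * M (i + 2) (i + 1))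
      - M i (i + 1) * (M (i + 1) i * M (i + 2) (i + 2) - M (i + 1) (i + 2) * M (i + 2) i)
      + M i (i + 2) * (M (i + 1) i * M (i + 2) (i + 1) - M (i + 1) (i + 1) * M (i + 2) i) := by
  rw [Matrix.det_fin_three]
  fin_cases i <;> simp <;> ring

theorem eq_rotMat_of_mem_axisStab {i : Fin 3} {g : SO3} (hg : g ∈ axisStab i)
    (h1 : g.1 i i = 1) :
    g.1 = rotMat i (g.1 (i + 1) (i + 1)) (g.1 (i + 2) (i + 1)) ∧
      g.1 (i + 1) (i + 1) ^ 2 + g.1 (i + 2) (i + 1) ^ 2 = 1 := by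
  have hrow : ∀ j, j ≠ i → g.1 i j = 0 := hg
  have hcol : ∀ j, j ≠ i → g.1 j i = 0 := fun j hj => by
    have := (axisStab i).inv_mem hg j hj
    rwa [SO3.coe_inv, Matrix.transpose_apply] at this
  have hdet := g.det_eq
  have ha := g.row_dot (i + 1) (i + 1)
  have hb := g.row_dot (i + 2) (i + 2)
  have hc := g.col_dot (i + 1) (i + 1)
  obtain ⟨n1, n2⟩ : i + 1 ≠ i ∧ i + 2 ≠ i := by
    clear * -
    revert i
    decide
  rw [det_cyclic i, h1, hrow _ n1, hrow _ n2] at hdet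
  rw [if_pos rfl, sum_cyclic i] at ha hb hc
  rw [hcol _ n1] at ha
  rw [hcol _ n2] at hb
  rw [hrow _ n1] at hc
  -- Expanded, this is the sum of the squared lengths of two rows minus twice the determinant, that
  -- is `1 + 1 - 2`.
  have hsq : (g.1 (i + 1) (i + 1) - g.1 (i + 2) (i + 2)) ^ 2 +
      (g.1 (i + 1) (i + 2) + g.1 (i + 2) (i + 1)) ^ 2 = 0 := by
    linear_combination ha + hb - 2 * hdet
  have hd : g.1 (i + 2) (i + 2) = g.1 (i + 1) (i + 1) := by nlinarith
  have ho : g.1 (i + 1) (i + 2) = -g.1 (i + 2) (i + 1) := by nlinarith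
  refine ⟨?_, by linear_combination hc⟩
  obtain ⟨n3, n4⟩ : i + 2 ≠ i + 1 ∧ i + 1 ≠ i + 2 := by
    clear * -
    revert i
    decide
  have hcases : ∀ a, a = i ∨ a = i + 1 ∨ a = i + 2 := by
    clear * -
    revert i
    decide
  ext a b
  unfold rotMat
  obtain rfl | rfl | rfl := hcases a <;> obtain rfl | rfl | rfl := hcases b <;>
    simp only [if_true, if_false, n1, n2, n3, n4, h1, hrow _ n1, hrow _ n2, hcol _ n1, hcol _ n2,
      hd, ho]

/-- The sign `g i i = ±1` is multiplicative, and its kernel consists of rotations about one axis,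
which commute. -/
instance isSolvable_axisStab (i : Fin 3) : Group.IsSolvable (axisStab i) := by
  let f : axisStab i →* ℝ :=
    { toFun := fun g => g.1.1 i i
      map_one' := Matrix.one_apply_eq i
      map_mul' := fun g h => axisStab_diag_mul g.2 h }
  let F : axisStab i →* ℝˣ := f.toHomUnits
  have hcomm : ∀ a b : F.ker, a * b = b * a := by
    have hone : ∀ a : F.ker, a.1.1.1 i i = 1 := fun a => congrArg Units.val a.2
    intro a b
    apply Subtype.ext
    apply Subtype.ext
    apply Subtype.ext
    change a.1.1.1 * b.1.1.1 = b.1.1.1 * a.1.1.1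
    rw [(eq_rotMat_of_mem_axisStab a.1.2 (hone a)).1, (eq_rotMat_of_mem_axisStab b.1.2 (hone b)).1,
      rotMat_mul, rotMat_mul]
    congr 1 <;> ring
  have : Group.IsSolvable F.ker := Group.isSolvable_of_comm hcomm
  exact Group.isSolvable_of_ker_le_range F.ker.subtype F (by simp)

/-- The rotations with integral matrix entries. -/
def integralSO3 : Subgroup SO3 where
  carrier := {g | ∀ i j, ∃ n : ℤ, g.1 i j = n}
  one_mem' i j := ⟨if i = j then 1 else 0, by
    rw [Submonoid.coe_one, Matrix.one_apply]; split_ifs <;> simp⟩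
  mul_mem' {g h} hg hh i j := by
    choose a ha using hg
    choose b hb using hh
    refine ⟨∑ k, a i k * b k j, ?_⟩
    rw [Submonoid.coe_mul, Matrix.mul_apply]
    push_cast
    simp only [ha, hb]
  inv_mem' {g} hg i j := by
    rw [SO3.coe_inv, Matrix.transpose_apply]
    exact hg j i

/-- Integers whose squares add up to `1` are all zero except one; so integral rotations are signed
permutation matrices. -/
theorem integralSO3_exists {g : SO3} (hg : g ∈ integralSO3) (j : Fin 3) :
    ∃ i, ∀ k, g.1 k j ≠ 0 ↔ k = i := by
  choose a ha using hg
  have h := g.col_dot j j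
  simp only [ha, if_pos] at h
  have h' : ∑ k, a k j * a k j = 1 := by exact_mod_cast h
  have hex : ∃ i, a i j ≠ 0 := by
    by_contra! hcon
    simp [hcon] at h'
  obtain ⟨i, hi⟩ := hex
  refine ⟨i, fun k => ?_⟩
  rw [ha, Int.cast_ne_zero]
  refine ⟨fun hk => ?_, fun hk => hk ▸ hi⟩
  by_contra hne
  have hle : ∑ k ∈ {k, i}, a k j * a k j ≤ ∑ k, a k j * a k j :=
    Finset.sum_le_sum_of_subset_of_nonneg (Finset.subset_univ _) fun _ _ _ => mul_self_nonneg _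
  rw [h', Finset.sum_pair hne] at hle
  have h1 : 0 < a k j * a k j := mul_self_pos.mpr hk
  have h2 : 0 < a i j * a i j := mul_self_pos.mpr hi
  omega

theorem isSolvable_perm_fin_three : Group.IsSolvable (Equiv.Perm (Fin 3)) := by
  have hcomm : ∀ a b : Equiv.Perm (Fin 3), Equiv.Perm.sign a = 1 → Equiv.Perm.sign b = 1 →
      a * b = b * a := by decide
  let F : Equiv.Perm (Fin 3) →* ℤˣ := Equiv.Perm.sign
  have : Group.IsSolvable F.ker :=
    Group.isSolvable_of_comm fun a b => Subtype.ext (hcomm a.1 b.1 a.2 b.2)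
  exact Group.isSolvable_of_ker_le_range F.ker.subtype F (by simp)

/-- The positions of the nonzero entries give a homomorphism to the solvable group of permutations
of the axes; its kernel consists of diagonal matrices, which commute. -/
instance isSolvable_integralSO3 : Group.IsSolvable integralSO3 := by
  choose π hπ using fun g : integralSO3 => integralSO3_exists g.2
  have huniq : ∀ (g : integralSO3) (i j : Fin 3), g.1.1 i j ≠ 0 → i = π g j :=
    fun g i j h => (hπ g j i).mp h
  have hne : ∀ (g : integralSO3) (j : Fin 3), g.1.1 (π g j) j ≠ 0 :=
    fun g j => (hπ g j _).mpr rfl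
  let f : integralSO3 →* Function.End (Fin 3) :=
    { toFun := π
      map_one' := by
        funext j
        refine (huniq 1 j j ?_).symm
        change (1 : Matrix (Fin 3) (Fin 3) ℝ) j j ≠ 0
        simp
      map_mul' := fun g h => by
        funext j
        refine (huniq (g * h) (π g (π h j)) j ?_).symm
        change (g.1.1 * h.1.1) _ _ ≠ 0
        rw [Matrix.mul_apply, Finset.sum_eq_single (π h j) (fun k _ hk => ?_) (by simp)]
        · exact mul_ne_zero (hne g _) (hne h j)
        · rw [not_not.mp (mt (huniq h k j) hk), mul_zero] }
  let F : integralSO3 →* Equiv.Perm (Fin 3) := MonoidHom.toHomPerm f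
  have hdiag : ∀ a : F.ker, ∀ i j, i ≠ j → a.1.1.1 i j = 0 := by
    intro a i j hij
    by_contra h
    have h1 := huniq a.1 i j h
    have h2 : π a.1 j = j := congrArg (fun e : Equiv.Perm (Fin 3) => e j) a.2
    exact hij (h1.trans h2)
  have hcomm : ∀ a b : F.ker, a * b = b * a := by
    intro a b
    have hd : ∀ a : F.ker, a.1.1.1 = Matrix.diagonal fun i => a.1.1.1 i i := by
      intro a
      ext i j
      by_cases hij : i = j
      · rw [hij, Matrix.diagonal_apply_eq]
      · rw [Matrix.diagonal_apply_ne _ hij, hdiag a i j hij]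
    apply Subtype.ext
    apply Subtype.ext
    apply Subtype.ext
    change a.1.1.1 * b.1.1.1 = b.1.1.1 * a.1.1.1
    rw [hd a, hd b, Matrix.diagonal_mul_diagonal, Matrix.diagonal_mul_diagonal]
    congr 1
    funext i
    exact mul_comm _ _
  have : Group.IsSolvable F.ker := Group.isSolvable_of_comm hcomm
  have := isSolvable_perm_fin_three
  exact Group.isSolvable_of_ker_le_range F.ker.subtype F (by simp)

theorem continuous_SO3_entry (i j : Fin 3) : Continuous fun g : SO3 => g.1 i j :=
  continuous_subtype_val.matrix_elem i j

/-- Integral rotations close to the identity are trivial. -/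
theorem eventually_integralSO3_eq_one : ∀ᶠ g : SO3 in 𝓝 1, g ∈ integralSO3 → g = 1 := by
  have h : ∀ i j : Fin 3, ∀ᶠ g : SO3 in 𝓝 1,
      |g.1 i j - (1 : Matrix (Fin 3) (Fin 3) ℝ) i j| < 1 := by
    intro i j
    have hc : Continuous fun g : SO3 => |g.1 i j - (1 : Matrix (Fin 3) (Fin 3) ℝ) i j| :=
      ((continuous_SO3_entry i j).sub continuous_const).abs
    exact hc.continuousAt.eventually_lt_const (by simp)
  have h' : ∀ᶠ g : SO3 in 𝓝 1, ∀ i j, |g.1 i j - (1 : Matrix (Fin 3) (Fin 3) ℝ) i j| < 1 :=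
    eventually_all.mpr fun i => eventually_all.mpr fun j => h i j
  filter_upwards [h'] with g hg hint
  apply Subtype.ext
  ext i j
  obtain ⟨n, hn⟩ := hint i j
  obtain ⟨m, hm⟩ := integralSO3.one_mem i j
  have hm' : (1 : Matrix (Fin 3) (Fin 3) ℝ) i j = m := hm
  have hlt := hg i j
  rw [hn, hm'] at hlt
  have : |n - m| < 1 := by exact_mod_cast hlt
  rw [Int.abs_lt_one_iff, sub_eq_zero] at this
  rw [hn, this]
  exact hm.symm

/-- Rotations close to the identity that preserve a coordinate axis are rotations about this axis
by a small angle. -/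
theorem eventually_axisStab_eq_rot (i : Fin 3) {ε : ℝ} (hε : 0 < ε) :
    ∀ᶠ g : SO3 in 𝓝 1, g ∈ axisStab i → ∃ θ : ℝ, |θ| < ε ∧ g = rot i θ := by
  have h1 : ∀ᶠ g : SO3 in 𝓝 1, 0 < g.1 i i :=
    (continuous_SO3_entry i i).continuousAt.eventually_const_lt (by simp)
  have h2 : ∀ᶠ g : SO3 in 𝓝 1, 0 < g.1 (i + 1) (i + 1) :=
    (continuous_SO3_entry _ _).continuousAt.eventually_const_lt (by simp)
  have h3 : ∀ᶠ g : SO3 in 𝓝 1, |Real.arcsin (g.1 (i + 2) (i + 1))| < ε := by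
    have hc : Continuous fun g : SO3 => |Real.arcsin (g.1 (i + 2) (i + 1))| :=
      (Real.continuous_arcsin.comp (continuous_SO3_entry _ _)).abs
    refine hc.continuousAt.eventually_lt_const ?_
    have : (1 : SO3).1 (i + 2) (i + 1) = 0 := by
      refine Matrix.one_apply_ne ?_
      fin_cases i <;> decide
    change |Real.arcsin ((1 : SO3).1 (i + 2) (i + 1))| < ε
    rw [this]
    simpa using hε
  filter_upwards [h1, h2, h3] with g hg1 hg2 hg3 hg
  have hii : g.1 i i = 1 := by
    have := axisStab_diag_sq hg
    nlinarith
  obtain ⟨hrot, hsq⟩ := eq_rotMat_of_mem_axisStab hg hii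
  refine ⟨_, hg3, Subtype.ext ?_⟩
  have hs : Real.sin (Real.arcsin (g.1 (i + 2) (i + 1))) = g.1 (i + 2) (i + 1) :=
    Real.sin_arcsin (by nlinarith) (by nlinarith)
  have hc : Real.cos (Real.arcsin (g.1 (i + 2) (i + 1))) = g.1 (i + 1) (i + 1) := by
    rw [Real.cos_arcsin, ← hsq, add_sub_cancel_right, Real.sqrt_sq hg2.le]
  change _ = rotMat _ _ _
  rw [hs, hc, ← hrot]

end Rotations

/-! ### Pauli operators and the adjoint action on one qubit -/

section OneQubit

open Matrix

theorem forall_V {p : V → Prop} (h00 : p 0) (h01 : p (0, 1)) (h11 : p (1, 1)) (h10 : p (1, 0)) :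
    ∀ v, p v := by
  have hv : ∀ v : V, v = 0 ∨ v = (0, 1) ∨ v = (1, 1) ∨ v = (1, 0) := by decide
  intro v
  obtain rfl | rfl | rfl | rfl := hv v <;> assumption

theorem pauliOf_zero : pauliOf 0 = 1 := by
  simp [pauliOf]

theorem pauliOf_x : pauliOf (0, 1) = !![0, 1; 1, 0] := by
  simp [pauliOf, pauliX, ZMod.val_one]

theorem pauliOf_y : pauliOf (1, 1) = !![0, 1; -1, 0] := by
  simp [pauliOf, pauliX, pauliZ, ZMod.val_one]

theorem pauliOf_z : pauliOf (1, 0) = !![1, 0; 0, -1] := by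
  simp [pauliOf, pauliZ, ZMod.val_one]

theorem pauliOf_zero' : pauliOf 0 = !![1, 0; 0, 1] := by
  rw [pauliOf_zero, Matrix.one_fin_two]

theorem star_pauliOf_mul_self (a : V) : star (pauliOf a) * pauliOf a = 1 := by
  revert a
  refine forall_V ?_ ?_ ?_ ?_ <;>
    simp only [pauliOf_zero', pauliOf_x, pauliOf_y, pauliOf_z, star_eq_conjTranspose] <;>
    ext i j <;> fin_cases i <;> fin_cases j <;> simp [Matrix.mul_apply]

theorem trace_star_pauliOf_mul (a b : V) :
    (star (pauliOf a) * pauliOf b).trace = if a = b then 2 else 0 := by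
  revert a b
  refine forall_V ?_ ?_ ?_ ?_ <;> refine forall_V ?_ ?_ ?_ ?_ <;>
    simp only [pauliOf_zero', pauliOf_x, pauliOf_y, pauliOf_z, star_eq_conjTranspose,
      trace_fin_two] <;>
    simp [Matrix.mul_apply] <;> first | norm_num; done | decide

theorem trace_pauliOf (a : V) : (pauliOf a).trace = if a = 0 then 2 else 0 := by
  have := trace_star_pauliOf_mul 0 a
  rw [pauliOf_zero, star_one, one_mul] at this
  simpa [eq_comm] using this

/-- The symplectic form on `V`. -/
def form (a b : V) : ZMod 2 := a.1 * b.2 - a.2 * b.1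

/-- The character `ZMod 2 → {1, -1}`. -/
def sgn (a : ZMod 2) : ℂ := (-1) ^ a.val

theorem sgn_zero : sgn 0 = 1 := by simp [sgn]

theorem sgn_one : sgn 1 = -1 := by simp [sgn, ZMod.val_one]

theorem sgn_add (a b : ZMod 2) : sgn (a + b) = sgn a * sgn b := by
  have h : ∀ a b : ZMod 2, (a = 0 ∨ a = 1) ∧ (b = 0 ∨ b = 1) ∧ (1 + 1 : ZMod 2) = 0 := by decide
  obtain ⟨rfl | rfl, rfl | rfl, h2⟩ := h a b <;> simp [sgn_zero, sgn_one, h2]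

theorem sgn_sum {ι : Type*} (s : Finset ι) (f : ι → ZMod 2) :
    sgn (∑ i ∈ s, f i) = ∏ i ∈ s, sgn (f i) := by
  classical
  induction s using Finset.induction_on with
  | empty => simp [sgn_zero]
  | insert a s ha ih => rw [Finset.sum_insert ha, Finset.prod_insert ha, sgn_add, ih]

theorem pauliOf_mul_comm (a b : V) :
    pauliOf a * pauliOf b = sgn (form a b) • (pauliOf b * pauliOf a) := by
  have h : ∀ a b : V, form a b = if a = 0 ∨ b = 0 ∨ a = b then 0 else 1 := by decide
  rw [h]
  clear h
  revert a b
  refine forall_V ?_ ?_ ?_ ?_ <;> refine forall_V ?_ ?_ ?_ ?_ <;>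
    simp only [pauliOf_zero', pauliOf_x, pauliOf_y, pauliOf_z] <;>
    ext i j <;> fin_cases i <;> fin_cases j <;> simp [Matrix.mul_apply, sgn_zero, sgn_one]

theorem eq_sum_pauliOf (M : Matrix (Fin 2) (Fin 2) ℂ) :
    M = ∑ a : V, ((star (pauliOf a) * M).trace / 2) • pauliOf a := by
  have hsum : ∀ f : V → Matrix (Fin 2) (Fin 2) ℂ,
      ∑ a, f a = f 0 + f (0, 1) + f (1, 1) + f (1, 0) := by
    intro f
    have : (Finset.univ : Finset V) = {0, (0, 1), (1, 1), (1, 0)} := by decide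
    rw [this, Finset.sum_insert (by decide), Finset.sum_insert (by decide),
      Finset.sum_insert (by decide), Finset.sum_singleton]
    abel
  rw [hsum]
  simp only [pauliOf_zero', pauliOf_x, pauliOf_y, pauliOf_z, star_eq_conjTranspose, trace_fin_two]
  ext i j
  fin_cases i <;> fin_cases j <;> simp [Matrix.mul_apply] <;> ring

/-- The matrix coefficients of the adjoint action of `u` in the Pauli basis of all operators. -/
def adCoeff (u : U2) (a b : V) : ℂ :=
  (star (pauliOf a) * ((u : Matrix (Fin 2) (Fin 2) ℂ) * pauliOf b * star u.1)).trace

theorem U2.mul_star (u : U2) : u.1 * star u.1 = 1 := Matrix.mem_unitaryGroup_iff.mp u.2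

theorem U2.star_mul (u : U2) : star u.1 * u.1 = 1 := Matrix.mem_unitaryGroup_iff'.mp u.2

theorem adCoeff_one (a b : V) : adCoeff 1 a b = if a = b then 2 else 0 := by
  simp [adCoeff, trace_star_pauliOf_mul]

theorem adCoeff_zero_left (u : U2) (b : V) : adCoeff u 0 b = if b = 0 then 2 else 0 := by
  rw [adCoeff, pauliOf_zero, star_one, one_mul, trace_mul_comm, ← mul_assoc, u.star_mul, one_mul,
    trace_pauliOf]

theorem adCoeff_zero_right (u : U2) (a : V) : adCoeff u a 0 = if a = 0 then 2 else 0 := by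
  rw [adCoeff, pauliOf_zero, mul_one, u.mul_star, mul_one]
  have := trace_star_pauliOf_mul a 0
  rw [pauliOf_zero, mul_one] at this
  rw [this]

theorem adCoeff_inv (u : U2) (a b : V) : adCoeff u⁻¹ a b = star (adCoeff u b a) := by
  have hinv : ((u⁻¹ : U2) : Matrix (Fin 2) (Fin 2) ℂ) = star u.1 := rfl
  rw [adCoeff, adCoeff, hinv, star_star, star_eq_conjTranspose (pauliOf b), ← trace_conjTranspose,
    ← star_eq_conjTranspose]
  simp only [star_mul, star_star, ← star_eq_conjTranspose, mul_assoc]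
  rw [trace_mul_comm u.1]
  simp only [mul_assoc]

/-- The vector of `V` that corresponds to the `i`-th Pauli operator. -/
def axisVec : Fin 3 → V := ![(0, 1), (1, 1), (1, 0)]

theorem axisVec_ne_zero (i : Fin 3) : axisVec i ≠ 0 := by revert i; decide

theorem axisVec_injective : Function.Injective axisVec := by decide

theorem exists_axisVec_eq {a : V} (ha : a ≠ 0) : ∃ i, axisVec i = a := by revert a; decide

theorem pauliOf_axisVec (i : Fin 3) :
    pauliOf (axisVec i) = (![1, Complex.I, 1] i : ℂ) • pauliBase i := by
  fin_cases i
  · simp [axisVec, pauliBase, pauliOf_x, pauliX]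
  · simp [axisVec, pauliBase, pauliOf_y, pauliY]
  · simp [axisVec, pauliBase, pauliOf_z, pauliZ]

theorem norm_axisPhase (i : Fin 3) : ‖(![1, Complex.I, 1] i : ℂ)‖ = 1 := by
  fin_cases i <;> simp

theorem star_pauliBase (i : Fin 3) : star (pauliBase i) = pauliBase i := by
  fin_cases i <;> simp only [pauliBase, pauliX, pauliY, pauliZ, star_eq_conjTranspose] <;>
    ext a b <;> fin_cases a <;> fin_cases b <;> simp

theorem trace_pauliBase_mul (i j : Fin 3) :
    (pauliBase i * pauliBase j).trace = if i = j then 2 else 0 := by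
  fin_cases i <;> fin_cases j <;>
    simp [pauliBase, pauliX, pauliY, pauliZ, trace_fin_two] <;> norm_num

theorem Represents.adCoeff {u : U2} {g : SO3} (h : Represents u g) (i j : Fin 3) :
    adCoeff u (axisVec i) (axisVec j) =
      star (![1, Complex.I, 1] i : ℂ) * (![1, Complex.I, 1] j : ℂ) * (2 * (g.1 i j : ℂ)) := by
  rw [StabCode.adCoeff, pauliOf_axisVec, pauliOf_axisVec, mul_smul_comm, smul_mul_assoc, h j,
    star_smul, star_pauliBase, smul_mul_assoc, mul_smul_comm, smul_smul, trace_smul, smul_eq_mul,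
    Finset.mul_sum, trace_sum]
  congr 1
  rw [Finset.sum_eq_single i]
  · rw [mul_smul_comm, trace_smul, trace_pauliBase_mul, if_pos rfl, smul_eq_mul, mul_comm]
  · intro k _ hk
    rw [mul_smul_comm, trace_smul, trace_pauliBase_mul, if_neg hk.symm, smul_zero]
  · simp

/-- `pauliOf` represents `y` by `Z X = i Y`, so coefficient and matrix entry agree only up to a
phase and their absolute values are compared. The factor `2` is the trace of the identity. -/
theorem Represents.norm_adCoeff {u : U2} {g : SO3} (h : Represents u g) (i j : Fin 3) :
    ‖StabCode.adCoeff u (axisVec i) (axisVec j)‖ = 2 * |g.1 i j| := by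
  rw [h.adCoeff, norm_mul, norm_mul, norm_star, norm_axisPhase, norm_axisPhase, norm_mul,
    Complex.norm_real, Real.norm_eq_abs]
  simp

theorem eq_sum_pauliBase {H : Matrix (Fin 2) (Fin 2) ℂ} (hH : star H = H) (htr : H.trace = 0) :
    H = ∑ i, ((((pauliBase i * H).trace).re / 2 : ℝ) : ℂ) • pauliBase i := by
  have h00 := congrFun (congrFun hH 0) 0
  have h01 := congrFun (congrFun hH 0) 1
  rw [star_apply] at h00 h01
  rw [trace_fin_two] at htr
  have h11 : H 1 1 = -H 0 0 := by linear_combination htr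
  have h00' : (H 0 0).im = 0 := by
    have := congrArg Complex.im h00
    simp at this
    linarith
  have hX : (pauliBase 0 * H).trace = H 1 0 + H 0 1 := by
    rw [trace_fin_two, mul_apply, mul_apply]
    simp [pauliBase, pauliX]
  have hY : (pauliBase 1 * H).trace = -Complex.I * H 1 0 + Complex.I * H 0 1 := by
    rw [trace_fin_two, mul_apply, mul_apply]
    simp [pauliBase, pauliY]
  have hZ : (pauliBase 2 * H).trace = H 0 0 - H 1 1 := by
    rw [trace_fin_two, mul_apply, mul_apply]
    simp [pauliBase, pauliZ, sub_eq_add_neg]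
  rw [Fin.sum_univ_three, hX, hY, hZ]
  ext a b
  fin_cases a <;> fin_cases b <;>
    simp [pauliBase, pauliX, pauliY, pauliZ, h11, ← h01, Complex.ext_iff, h00']

/-- Conjugation preserves the traceless Hermitian matrices. Orthogonality follows from the
invariance of `tr (S T)`, and the determinant from `tr (X Y Z) = 2 i`. -/
theorem exists_represents (u : U2) : ∃ g : SO3, Represents u g := by
  let B : Fin 3 → Matrix (Fin 2) (Fin 2) ℂ := fun j => u.1 * pauliBase j * star u.1
  have hBstar : ∀ j, star (B j) = B j := fun j => by
    simp only [B, star_mul, star_star, star_pauliBase, mul_assoc]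
  have hBtr : ∀ j, (B j).trace = 0 := fun j => by
    simp only [B]
    rw [trace_mul_comm, ← mul_assoc, u.star_mul, one_mul]
    fin_cases j <;> simp [pauliBase, pauliX, pauliY, pauliZ, trace_fin_two]
  have hBmul : ∀ X Y : Matrix (Fin 2) (Fin 2) ℂ,
      (u.1 * X * star u.1) * (u.1 * Y * star u.1) = u.1 * (X * Y) * star u.1 := by
    intro X Y
    calc (u.1 * X * star u.1) * (u.1 * Y * star u.1)
        = u.1 * X * (star u.1 * u.1) * Y * star u.1 := by simp only [mul_assoc]
      _ = _ := by rw [u.star_mul, mul_one]; simp only [mul_assoc]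
  let M : Matrix (Fin 3) (Fin 3) ℝ := fun i j => ((pauliBase i * B j).trace).re / 2
  have hrep : ∀ j, B j = ∑ i, ((M i j : ℝ) : ℂ) • pauliBase i :=
    fun j => eq_sum_pauliBase (hBstar j) (hBtr j)
  have horth : M.transpose * M = 1 := by
    ext i j
    have h1 : (B i * B j).trace = if i = j then 2 else 0 := by
      simp only [B]
      rw [hBmul, trace_mul_comm, ← mul_assoc, u.star_mul, one_mul, trace_pauliBase_mul]
    rw [hrep i, hrep j, Finset.sum_mul, trace_sum] at h1
    have h2 : ∀ k, (((M k i : ℝ) : ℂ) • pauliBase k * ∑ l, ((M l j : ℝ) : ℂ) • pauliBase l).trace =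
        2 * (M k i * M k j : ℝ) := by
      intro k
      rw [Finset.mul_sum, trace_sum, Finset.sum_eq_single k]
      · rw [smul_mul_assoc, mul_smul_comm, trace_smul, trace_smul, trace_pauliBase_mul, if_pos rfl]
        push_cast
        simp only [smul_eq_mul]
        ring
      · intro l _ hl
        rw [smul_mul_assoc, mul_smul_comm, trace_smul, trace_smul, trace_pauliBase_mul,
          if_neg hl.symm, smul_zero, smul_zero]
      · simp
    rw [Finset.sum_congr rfl fun k _ => h2 k, ← Finset.mul_sum, ← Complex.ofReal_sum] at h1
    rw [Matrix.mul_apply, Matrix.one_apply]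
    simp only [transpose_apply]
    split_ifs at h1 ⊢ with hij
    · have : ((∑ k, M k i * M k j : ℝ) : ℂ) = 1 := by linear_combination h1 / 2
      exact_mod_cast this
    · have : ((∑ k, M k i * M k j : ℝ) : ℂ) = 0 := by linear_combination h1 / 2
      exact_mod_cast this
  have hdet : M.det = 1 := by
    have h1 : (B 0 * B 1 * B 2).trace = 2 * Complex.I := by
      simp only [B]
      rw [hBmul, hBmul, trace_mul_comm, ← mul_assoc, u.star_mul, one_mul]
      simp [pauliBase, pauliX, pauliY, pauliZ, trace_fin_two]
      ring
    rw [hrep 0, hrep 1, hrep 2] at h1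
    simp only [Fin.sum_univ_three] at h1
    have h2 := congrArg Complex.im h1
    simp [pauliBase, pauliX, pauliY, pauliZ, trace_fin_two] at h2
    rw [Matrix.det_fin_three]
    linear_combination h2 / 2
  exact ⟨⟨M, SO3.mk_mem (mul_eq_one_comm.mp horth) hdet⟩, hrep⟩

/-- The quotient `u⁻¹ * w` represents `1`, so it commutes with `X` and `Z` and is a scalar. -/
theorem Represents.eq_smul {u w : U2} {g : SO3} (hu : Represents u g) (hw : Represents w g) :
    ∃ c : ℂ, w.1 = c • u.1 := by
  have hone : Represents (u⁻¹ * w) 1 := by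
    have := hu.inv.mul hw
    rwa [inv_mul_cancel] at this
  set x : U2 := u⁻¹ * w with hx
  have hcomm : ∀ j, x.1 * pauliBase j = pauliBase j * x.1 := by
    intro j
    have h1 := hone j
    have h2 : ∑ i, (((1 : SO3) : Matrix (Fin 3) (Fin 3) ℝ) i j : ℂ) • pauliBase i =
        pauliBase j := by
      simp [Matrix.one_apply]
    rw [h2] at h1
    calc x.1 * pauliBase j = x.1 * pauliBase j * (star x.1 * x.1) := by rw [x.star_mul, mul_one]
      _ = x.1 * pauliBase j * star x.1 * x.1 := by simp only [mul_assoc]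
      _ = _ := by rw [h1]
  refine ⟨x.1 0 0, ?_⟩
  have hX := hcomm 0
  have hZ := hcomm 2
  have h10 := congrFun (congrFun hZ 0) 1
  have h01 := congrFun (congrFun hZ 1) 0
  have h11 := congrFun (congrFun hX 0) 1
  simp [pauliBase, pauliX, pauliZ, Matrix.mul_apply] at h10 h01 h11
  have e10 : x.1 0 1 = 0 := by linear_combination -h10 / 2
  have e01 : x.1 1 0 = 0 := by linear_combination h01 / 2
  have hscal : x.1 = x.1 0 0 • (1 : Matrix (Fin 2) (Fin 2) ℂ) := by
    ext a b
    fin_cases a <;> fin_cases b <;> simp [e10, e01, h11]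
  have hw : w.1 = u.1 * x.1 := by
    have : w = u * x := by rw [hx, mul_inv_cancel_left]
    rw [this]
    rfl
  rw [hw]
  conv_lhs => rw [hscal]
  rw [mul_smul_comm, mul_one]

end OneQubit

theorem neg_eq_self {P : Type*} {L : Submodule (ZMod 2) (P → V)} (v : L) : -v = v := by
  apply Subtype.ext
  funext p
  have : ∀ a : V, -a = a := by decide
  exact this _

theorem mulSingle_mul_update {P : Type*} [DecidableEq P] (u : P → U2) (p : P) :
    Pi.mulSingle p (u p) * Function.update u p 1 = u := by
  funext q
  by_cases hq : q = p
  · subst hq; simp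
  · simp [hq]

/-! ### Tensor products of Pauli operators -/

section Tensor

open Matrix

variable {P : Type*} [Fintype P]

theorem trace_tensorMat [DecidableEq P] (M : P → Matrix (Fin 2) (Fin 2) ℂ) :
    (tensorMat M).trace = ∏ p, (M p).trace := by
  simp only [Matrix.trace, tensorMat, diag_apply, of_apply]
  rw [Fintype.prod_sum]

theorem tensorMat_smul (c : P → ℂ) (M : P → Matrix (Fin 2) (Fin 2) ℂ) :
    (tensorMat fun p => c p • M p) = (∏ p, c p) • tensorMat M := by
  ext a b
  simp [tensorMat, Finset.prod_mul_distrib]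

theorem tensorMat_sum [DecidableEq P] {ι : Type*} [Fintype ι]
    (M : P → ι → Matrix (Fin 2) (Fin 2) ℂ) :
    (tensorMat fun p => ∑ i, M p i) = ∑ w : P → ι, tensorMat fun p => M p (w p) := by
  ext a b
  simp only [tensorMat, of_apply, Matrix.sum_apply]
  rw [Fintype.prod_sum]

/-- The tensor product of Pauli operators given by a vector of `V ^ P`. -/
def pauliTensor (v : P → V) : Matrix (P → Fin 2) (P → Fin 2) ℂ :=
  tensorMat fun p => pauliOf (v p)

variable [DecidableEq P]

theorem star_pauliTensor_mul_self (v : P → V) : star (pauliTensor v) * pauliTensor v = 1 := by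
  rw [pauliTensor, tensorMat_star, ← tensorMat_mul, ← tensorMat_one]
  congr 1
  funext p
  exact star_pauliOf_mul_self (v p)

theorem pauliTensor_mul_comm (v w : P → V) :
    pauliTensor v * pauliTensor w = sgn (omega v w) • (pauliTensor w * pauliTensor v) := by
  simp only [pauliTensor]
  rw [← tensorMat_mul, ← tensorMat_mul, omega, sgn_sum, ← tensorMat_smul]
  congr 1
  funext p
  exact pauliOf_mul_comm (v p) (w p)

theorem tensorMat_eq_sum_pauliTensor (M : P → Matrix (Fin 2) (Fin 2) ℂ) :
    tensorMat M =
      ∑ w : P → V, (∏ p, (star (pauliOf (w p)) * M p).trace / 2) • pauliTensor w := by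
  conv_lhs => rw [show M = fun p => ∑ a : V, ((star (pauliOf a) * M p).trace / 2) • pauliOf a from
    funext fun p => eq_sum_pauliOf (M p)]
  rw [tensorMat_sum]
  refine Finset.sum_congr rfl fun w _ => ?_
  rw [pauliTensor, ← tensorMat_smul]

theorem coe_tensorU (u : P → U2) :
    ((tensorU u : UnitaryOn P) : Matrix (P → Fin 2) (P → Fin 2) ℂ) =
      tensorMat fun p => (u p).1 := rfl

theorem ofLp_act (U : UnitaryOn P) (ψ : StateSpace P) :
    (act U ψ).ofLp = U.1 *ᵥ ψ.ofLp := rfl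

theorem mulVec_ext {n : Type*} [Fintype n] [DecidableEq n] {M N : Matrix n n ℂ}
    (h : ∀ x, M *ᵥ x = N *ᵥ x) : M = N := by
  ext i j
  have := congrFun (h (Pi.single j 1)) i
  simpa using this

end Tensor

/-! ### The code projection and the comparison of Pauli coefficients -/

section Stabilizer

open Matrix

variable {P : Type*} [Fintype P] [DecidableEq P] {L : Submodule (ZMod 2) (P → V)} (σ : Sec L)

instance fintypeSubmodule : Fintype L := Fintype.ofFinite L

/-- The matrices of the stabilizer group. -/
def stabMat (v : L) : Matrix (P → Fin 2) (P → Fin 2) ℂ :=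
  (σ.hom (Multiplicative.ofAdd v) : UnitaryOn P).1

theorem exists_stabMat_eq (v : L) : ∃ c : ℂ, ‖c‖ = 1 ∧ stabMat σ v = c • pauliTensor v.1 := by
  obtain ⟨c, hc⟩ := σ.liesOver v
  refine ⟨c, ?_, hc⟩
  have h1 : star (stabMat σ v) * stabMat σ v = 1 :=
    Matrix.mem_unitaryGroup_iff'.mp (σ.hom (Multiplicative.ofAdd v) : UnitaryOn P).2
  have hc' : stabMat σ v = c • pauliTensor v.1 := hc
  rw [hc', star_smul, smul_mul_assoc, mul_smul_comm, star_pauliTensor_mul_self, smul_smul] at h1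
  have h2 := congrFun (congrFun h1 0) 0
  simp only [Matrix.smul_apply, Matrix.one_apply_eq, smul_eq_mul, mul_one] at h2
  have h3 := congrArg norm h2
  rw [norm_mul, norm_star, norm_one] at h3
  nlinarith [norm_nonneg c]

/-- The phase of a stabilizer relative to the tensor product of Pauli operators. -/
def stabPhase (v : L) : ℂ := (exists_stabMat_eq σ v).choose

theorem norm_stabPhase (v : L) : ‖stabPhase σ v‖ = 1 := (exists_stabMat_eq σ v).choose_spec.1

theorem stabMat_eq (v : L) : stabMat σ v = stabPhase σ v • pauliTensor v.1 :=
  (exists_stabMat_eq σ v).choose_spec.2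

theorem stabPhase_ne_zero (v : L) : stabPhase σ v ≠ 0 := by
  intro h
  have := norm_stabPhase σ v
  rw [h, norm_zero] at this
  exact zero_ne_one this

theorem stabMat_add (v w : L) : stabMat σ (v + w) = stabMat σ v * stabMat σ w := by
  simp only [stabMat, ofAdd_add, map_mul]
  rfl

theorem stabMat_zero : stabMat σ 0 = 1 := by
  simp only [stabMat, ofAdd_zero, map_one]
  rfl

theorem star_stabMat (v : L) : star (stabMat σ v) = stabMat σ v := by
  have h : star (stabMat σ v) = stabMat σ (-v) := by
    simp only [stabMat, ofAdd_neg, map_inv]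
    rfl
  rw [h, neg_eq_self]

theorem mem_code_iff {ψ : StateSpace P} :
    ψ ∈ code σ ↔ ∀ v : L, stabMat σ v *ᵥ ψ.ofLp = ψ.ofLp := by
  refine forall_congr' fun v => ?_
  rw [← (WithLp.ofLp_injective 2).eq_iff, ofLp_act]
  rfl

/-- The sum of all stabilizers, a multiple of the orthogonal projection to the code. -/
def stabSum : Matrix (P → Fin 2) (P → Fin 2) ℂ := ∑ v : L, stabMat σ v

theorem stabMat_mul_stabSum (v : L) : stabMat σ v * stabSum σ = stabSum σ := by
  rw [stabSum, Finset.mul_sum]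
  simp only [← stabMat_add]
  exact Equiv.sum_comp (Equiv.addLeft v) fun w => stabMat σ w

theorem star_stabSum : star (stabSum σ) = stabSum σ := by
  rw [stabSum, star_sum]
  simp only [star_stabMat]

theorem stabSum_mul_of_preserves (U : UnitaryOn P) (h : ∀ ψ ∈ code σ, act U ψ ∈ code σ) :
    stabSum σ * (U.1 * stabSum σ) = (Fintype.card L : ℂ) • (U.1 * stabSum σ) := by
  have hst : ∀ v, stabMat σ v * (U.1 * stabSum σ) = U.1 * stabSum σ := by
    intro v
    refine mulVec_ext fun x => ?_
    have hx : WithLp.toLp 2 (stabSum σ *ᵥ x) ∈ code σ := by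
      rw [mem_code_iff]
      intro w
      rw [mulVec_mulVec, stabMat_mul_stabSum]
    have := (mem_code_iff σ).mp (h _ hx) v
    rw [ofLp_act] at this
    simpa only [mulVec_mulVec, mul_assoc] using this
  conv_lhs => rw [stabSum, Finset.sum_mul, ← stabSum]
  rw [Finset.sum_congr rfl fun v _ => hst v, Finset.sum_const, Finset.card_univ,
    ← Nat.cast_smul_eq_nsmul ℂ]

/-- With `S` the sum of stabilizers, invariance of the code under `U` gives `S U S = |L| U S`.
Invariance under `U⁻¹` gives, after taking adjoints, `S U S = |L| S U`. -/
theorem mul_stabSum_comm (U : UnitaryOn P) (h : ∀ ψ ∈ code σ, act U ψ ∈ code σ) :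
    U.1 * stabSum σ = stabSum σ * U.1 := by
  have h1 := stabSum_mul_of_preserves σ U h
  have h2 := stabSum_mul_of_preserves σ U⁻¹ (act_inv_mem _ _ h)
  have hinv : ((U⁻¹ : UnitaryOn P) : Matrix (P → Fin 2) (P → Fin 2) ℂ) = star U.1 := rfl
  rw [hinv] at h2
  have h3 := congrArg star h2
  simp only [star_mul, star_smul, star_stabSum, star_star, star_natCast, mul_assoc] at h3
  have h4 : (Fintype.card L : ℂ) • (U.1 * stabSum σ) =
      (Fintype.card L : ℂ) • (stabSum σ * U.1) := by
    rw [← h1, ← h3]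
  exact smul_right_injective _ (Nat.cast_ne_zero.mpr Fintype.card_ne_zero) h4

theorem trace_conj_stabSum (x : P → U2) (w : P → V) :
    (star (pauliTensor w) *
      ((tensorU x).1 * stabSum σ * star (tensorU x).1)).trace =
      ∑ v : L, stabPhase σ v * ∏ p, adCoeff (x p) (w p) (v.1 p) := by
  rw [stabSum, Finset.mul_sum, Finset.sum_mul, Finset.mul_sum, trace_sum]
  refine Finset.sum_congr rfl fun v _ => ?_
  rw [stabMat_eq, mul_smul_comm, smul_mul_assoc, mul_smul_comm, trace_smul, smul_eq_mul,
    coe_tensorU, pauliTensor, pauliTensor, tensorMat_star, tensorMat_star, ← tensorMat_mul,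
    ← tensorMat_mul, ← tensorMat_mul, trace_tensorMat]
  rfl

/-- The two sides are the coefficients at `w`, taken as traces, of `A⁻¹ S A` and `B S B⁻¹`, where
`S` is the sum of stabilizers, `A` is the part of the local unitary at `p` and `B` the part at the
other qubits. Where a part is trivial, its coefficients are `2` or `0`. -/
theorem transfer {u : P → U2} (h : ∀ ψ ∈ code σ, act (tensorU u) ψ ∈ code σ) (p : P)
    (w : P → V) :
    ∑ v : L, stabPhase σ v * (star (adCoeff (u p) (v.1 p) (w p)) *
        ∏ q ∈ Finset.univ.erase p, if w q = v.1 q then (2 : ℂ) else 0) =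
      ∑ v : L, stabPhase σ v * ((if w p = v.1 p then (2 : ℂ) else 0) *
        ∏ q ∈ Finset.univ.erase p, adCoeff (u q) (w q) (v.1 q)) := by
  have hcomm := mul_stabSum_comm σ _ h
  set A : UnitaryOn P := tensorU (Pi.mulSingle p (u p)) with hA
  set B : UnitaryOn P := tensorU (Function.update u p 1) with hB
  have hAB : (tensorU u).1 = A.1 * B.1 := by
    conv_lhs => rw [← mulSingle_mul_update u p, map_mul]
    rfl
  have hA1 : star A.1 * A.1 = 1 := Matrix.mem_unitaryGroup_iff'.mp A.2
  have hB1 : B.1 * star B.1 = 1 := Matrix.mem_unitaryGroup_iff.mp B.2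
  rw [hAB] at hcomm
  have hinv : (tensorU (Pi.mulSingle p (u p)⁻¹) : UnitaryOn P) = A⁻¹ := by
    rw [hA, ← map_inv, Pi.mulSingle_inv]
  have key : (tensorU (Pi.mulSingle p (u p)⁻¹) : UnitaryOn P).1 * stabSum σ *
      star (tensorU (Pi.mulSingle p (u p)⁻¹) : UnitaryOn P).1 = B.1 * stabSum σ * star B.1 := by
    rw [hinv]
    change star A.1 * stabSum σ * star (star A.1) = _
    rw [star_star]
    calc star A.1 * stabSum σ * A.1
        = star A.1 * (stabSum σ * (A.1 * (B.1 * star B.1))) := by rw [hB1, mul_one, mul_assoc]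
      _ = star A.1 * ((stabSum σ * (A.1 * B.1)) * star B.1) := by simp only [mul_assoc]
      _ = star A.1 * ((A.1 * B.1 * stabSum σ) * star B.1) := by rw [hcomm]
      _ = (star A.1 * A.1) * (B.1 * stabSum σ * star B.1) := by simp only [mul_assoc]
      _ = _ := by rw [hA1, one_mul]
  have h1 := trace_conj_stabSum σ (Pi.mulSingle p (u p)⁻¹) w
  have h2 := trace_conj_stabSum σ (Function.update u p 1) w
  rw [key, h2] at h1
  symm
  refine Eq.trans (Finset.sum_congr rfl fun v _ => ?_) (h1.trans
    (Finset.sum_congr rfl fun v _ => ?_))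
  · rw [← Finset.mul_prod_erase _ _ (Finset.mem_univ p), Function.update_self, adCoeff_one]
    refine congrArg (fun t => stabPhase σ v * (_ * t)) (Finset.prod_congr rfl fun q hq => ?_)
    rw [Function.update_of_ne (Finset.ne_of_mem_erase hq)]
  · rw [← Finset.mul_prod_erase _ _ (Finset.mem_univ p), Pi.mulSingle_eq_same, adCoeff_inv]
    refine congrArg (fun t => stabPhase σ v * (_ * t)) (Finset.prod_congr rfl fun q hq => ?_)
    rw [Pi.mulSingle_eq_of_ne (Finset.ne_of_mem_erase hq), adCoeff_one]

/-- In `transfer`, taken at `v₀` with its entry at `p` replaced by `b`, only `v₀` survives on the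
left: by `huniq` any other `v` vanishes at `p` or differs from `v₀` elsewhere. -/
theorem transfer_update {u : P → U2} (h : ∀ ψ ∈ code σ, act (tensorU u) ψ ∈ code σ) (p : P)
    (v₀ : L) {b : V} (hb : b ≠ 0)
    (huniq : ∀ v : L, v.1 p ≠ 0 → (∀ q, q ≠ p → v.1 q = v₀.1 q) → v = v₀) :
    stabPhase σ v₀ * (star (adCoeff (u p) (v₀.1 p) b) * 2 ^ (Finset.univ.erase p).card) =
      ∑ v : L, stabPhase σ v * ((if b = v.1 p then (2 : ℂ) else 0) *
        ∏ q ∈ Finset.univ.erase p, adCoeff (u q) (v₀.1 q) (v.1 q)) := by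
  have ht := transfer σ h p (Function.update v₀.1 p b)
  rw [Function.update_self, Finset.sum_eq_single v₀] at ht
  · have h1 : (∏ q ∈ Finset.univ.erase p,
        if Function.update v₀.1 p b q = v₀.1 q then (2 : ℂ) else 0) =
        2 ^ (Finset.univ.erase p).card := by
      rw [Finset.prod_congr rfl fun q hq => ?_, Finset.prod_const]
      rw [Function.update_of_ne (Finset.ne_of_mem_erase hq), if_pos rfl]
    rw [h1] at ht
    rw [ht]
    refine Finset.sum_congr rfl fun v _ => ?_
    refine congrArg (fun t => stabPhase σ v * (_ * t)) (Finset.prod_congr rfl fun q hq => ?_)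
    rw [Function.update_of_ne (Finset.ne_of_mem_erase hq)]
  · intro v _ hv
    by_cases hvp : v.1 p = 0
    · rw [hvp, adCoeff_zero_left, if_neg hb, star_zero, zero_mul, mul_zero]
    · have hex : ∃ q, q ≠ p ∧ v.1 q ≠ v₀.1 q := by
        by_contra! hcon
        exact hv (huniq v hvp hcon)
      obtain ⟨q, hq, hne⟩ := hex
      rw [Finset.prod_eq_zero (Finset.mem_erase.mpr ⟨hq, Finset.mem_univ q⟩), mul_zero, mul_zero]
      rw [Function.update_of_ne hq, if_neg hne.symm]
  · simp

theorem adCoeff_eq_zero_of_not_iff (u : U2) {a b : V} (h : ¬(b = 0 ↔ a = 0)) :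
    adCoeff u a b = 0 := by
  by_cases ha : a = 0
  · have hb : b ≠ 0 := fun hb => h ⟨fun _ => ha, fun _ => hb⟩
    rw [ha, adCoeff_zero_left, if_neg hb]
  · have hb : b = 0 := by
      by_contra hb
      exact h ⟨fun h => absurd h hb, fun h => absurd h ha⟩
    rw [hb, adCoeff_zero_right, if_neg ha]

/-- Conjugation does not mix the identity with the traceless Pauli operators. So a term on the right
of `transfer_update` can be nonzero only if `v` has the value `b` at `p` and the same zeros as `v₀`
elsewhere, which `hnone` excludes. -/
theorem adCoeff_eq_zero_of_isolated {u : P → U2}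
    (h : ∀ ψ ∈ code σ, act (tensorU u) ψ ∈ code σ) (p : P) (v₀ : L) {b : V} (hb : b ≠ 0)
    (huniq : ∀ v : L, v.1 p ≠ 0 → (∀ q, q ≠ p → v.1 q = v₀.1 q) → v = v₀)
    (hnone : ∀ v : L, v.1 p = b → ∃ q, q ≠ p ∧ ¬(v.1 q = 0 ↔ v₀.1 q = 0)) :
    adCoeff (u p) (v₀.1 p) b = 0 := by
  have ht := transfer_update σ h p v₀ hb huniq
  rw [Finset.sum_eq_zero] at ht
  · have h2 : (2 : ℂ) ^ (Finset.univ.erase p).card ≠ 0 := pow_ne_zero _ two_ne_zero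
    have h3 := (mul_eq_zero.mp ht).resolve_left (stabPhase_ne_zero σ v₀)
    exact star_eq_zero.mp ((mul_eq_zero.mp h3).resolve_right h2)
  · intro v _
    by_cases hvp : v.1 p = b
    · obtain ⟨q, hq, hne⟩ := hnone v hvp
      rw [Finset.prod_eq_zero (Finset.mem_erase.mpr ⟨hq, Finset.mem_univ q⟩)
        (adCoeff_eq_zero_of_not_iff _ hne), mul_zero, mul_zero]
    · rw [if_neg (Ne.symm hvp), zero_mul, mul_zero]

/-- Here `hone` leaves the single term `v₁` on the right of `transfer_update`. Taking absolute
values removes the phases of the stabilizers, and dividing each coefficient by `2` absorbs the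
powers of two. -/
theorem norm_adCoeff_eq_prod {u : P → U2}
    (h : ∀ ψ ∈ code σ, act (tensorU u) ψ ∈ code σ) (p : P) (v₀ v₁ : L) (hb : v₁.1 p ≠ 0)
    (huniq : ∀ v : L, v.1 p ≠ 0 → (∀ q, q ≠ p → v.1 q = v₀.1 q) → v = v₀)
    (hone : ∀ v : L, v.1 p = v₁.1 p → (∀ q, q ≠ p → (v.1 q = 0 ↔ v₀.1 q = 0)) → v = v₁) :
    ‖adCoeff (u p) (v₀.1 p) (v₁.1 p)‖ / 2 =
      ∏ q ∈ Finset.univ.erase p, (‖adCoeff (u q) (v₀.1 q) (v₁.1 q)‖ / 2) := by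
  have ht := transfer_update σ h p v₀ hb huniq
  rw [Finset.sum_eq_single v₁] at ht
  · have hn := congrArg norm ht
    rw [if_pos rfl] at hn
    simp only [norm_mul, norm_stabPhase, norm_star, norm_pow, norm_prod, one_mul,
      Complex.norm_ofNat] at hn
    rw [Finset.prod_div_distrib, Finset.prod_const]
    have h2 : (2 : ℝ) ^ (Finset.univ.erase p).card ≠ 0 := pow_ne_zero _ two_ne_zero
    field_simp
    linarith
  · intro v _ hv
    by_cases hvp : v.1 p = v₁.1 p
    · have hex : ∃ q, q ≠ p ∧ ¬(v.1 q = 0 ↔ v₀.1 q = 0) := by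
        by_contra! hcon
        exact hv (hone v hvp hcon)
      obtain ⟨q, hq, hne⟩ := hex
      rw [Finset.prod_eq_zero (Finset.mem_erase.mpr ⟨hq, Finset.mem_univ q⟩)
        (adCoeff_eq_zero_of_not_iff _ hne), mul_zero, mul_zero]
    · rw [if_neg (Ne.symm hvp), zero_mul, mul_zero]
  · simp

end Stabilizer

/-! ### The three types of qubits -/

section LocalTypes

theorem V.add_eq_zero_iff : ∀ {a b : V}, a + b = 0 ↔ a = b := by decide

theorem V.eq_of_third {a b c : V} (ha : a ≠ 0) (hb : b ≠ 0) (hc : c ≠ 0) (hab : a ≠ b)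
    (hcb : c ≠ b) (h : b + a ≠ c) : a = c := by
  have key : ∀ a b c : V, a ≠ 0 ∧ b ≠ 0 ∧ c ≠ 0 ∧ a ≠ b ∧ c ≠ b ∧ b + a ≠ c → a = c := by decide
  exact key a b c ⟨ha, hb, hc, hab, hcb, h⟩

theorem V.cases_of_ne : ∀ {a b c : V}, a ≠ 0 → b ≠ 0 → a ≠ b → c ≠ 0 →
    c = a ∨ c = b ∨ c = a + b := by decide

theorem form_eq_one_of_ne : ∀ {a b : V}, a ≠ 0 → b ≠ 0 → a ≠ b → form a b = 1 := by decide

theorem SO3.abs_entry_le_one (g : SO3) (i j : Fin 3) : |g.1 i j| ≤ 1 := by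
  have := entry_norm_bound_of_unitary (Matrix.mem_specialUnitaryGroup_iff.mp g.2).1 i j
  simpa using this

/-- Since rows have unit length, the square of a diagonal entry is then an integer between `0` and
`1`. -/
theorem mem_integralSO3_of_off_diag {g : SO3}
    (h : ∀ i j, i ≠ j → |g.1 i j| = 0 ∨ |g.1 i j| = 1) : g ∈ integralSO3 := by
  have key : ∀ i j, i ≠ j → ∃ n : ℤ, g.1 i j = n := by
    intro i j hij
    rcases h i j hij with h0 | h1
    · exact ⟨0, by simpa using h0⟩
    · rcases eq_or_eq_neg_of_abs_eq h1 with h1 | h1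
      · exact ⟨1, by simpa using h1⟩
      · exact ⟨-1, by simpa using h1⟩
  intro i j
  by_cases hij : i = j
  · subst hij
    have hr := g.row_dot i i
    rw [if_pos rfl, sum_cyclic i] at hr
    obtain ⟨n1, n2⟩ : i ≠ i + 1 ∧ i ≠ i + 2 := by
      clear * -
      revert i
      decide
    obtain ⟨a, ha⟩ := key i (i + 1) n1
    obtain ⟨b, hb⟩ := key i (i + 2) n2
    rw [ha, hb] at hr
    have hsq : g.1 i i * g.1 i i = ((1 - a * a - b * b : ℤ) : ℝ) := by
      push_cast
      linarith
    have hnn : 0 ≤ 1 - a * a - b * b := by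
      have := mul_self_nonneg (g.1 i i)
      rw [hsq] at this
      exact_mod_cast this
    have hle : 1 - a * a - b * b ≤ 1 := by nlinarith [mul_self_nonneg a, mul_self_nonneg b]
    obtain h0 | h1 : 1 - a * a - b * b = 0 ∨ 1 - a * a - b * b = 1 := by omega
    · rw [h0] at hsq
      exact ⟨0, by simpa using hsq⟩
    · rw [h1] at hsq
      have : g.1 i i * g.1 i i = 1 := by simpa using hsq
      rcases mul_self_eq_one_iff.mp this with h | h
      · exact ⟨1, by simpa using h⟩
      · exact ⟨-1, by simpa using h⟩
  · exact key i j hij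

/-- Each of the three numbers is at most the product of the other two. If `m p > 0`, then `m p ≤ m q
≤ m p * m r` gives `m r = 1`, and `m r ≤ m p * m q ≤ m p` gives `m p = 1`. Two indices alone would
only yield `m p = m q`, which is why Bell pairs need a separate treatment. -/
theorem eq_zero_or_one_of_eq_prod_erase {P : Type*} [Fintype P] [DecidableEq P] (m : P → ℝ)
    (h0 : ∀ x, 0 ≤ m x) (h1 : ∀ x, m x ≤ 1) {p q r : P} (hpq : p ≠ q) (hpr : p ≠ r) (hqr : q ≠ r)
    (hp : m p = ∏ x ∈ Finset.univ.erase p, m x) (hq : m q = ∏ x ∈ Finset.univ.erase q, m x)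
    (hr : m r = ∏ x ∈ Finset.univ.erase r, m x) : m p = 0 ∨ m p = 1 := by
  have hle : ∀ x y z : P, x ≠ y → x ≠ z → y ≠ z → m x = ∏ w ∈ Finset.univ.erase x, m w →
      m x ≤ m y * m z := by
    intro x y z hxy hxz hyz hx
    rw [hx, ← Finset.mul_prod_erase _ _ (Finset.mem_erase.mpr ⟨hxy.symm, Finset.mem_univ y⟩),
      ← Finset.mul_prod_erase _ _ (Finset.mem_erase.mpr ⟨hyz.symm,
        Finset.mem_erase.mpr ⟨hxz.symm, Finset.mem_univ z⟩⟩), ← mul_assoc]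
    exact mul_le_of_le_one_right (mul_nonneg (h0 y) (h0 z))
      (Finset.prod_le_one (fun w _ => h0 w) fun w _ => h1 w)
  have a1 := hle p q r hpq hpr hqr hp
  have a2 := hle q p r hpq.symm hqr hpr hq
  have a3 := hle r p q hpr.symm hqr.symm hpq hr
  by_cases hz : m p = 0
  · exact Or.inl hz
  · right
    have hpos : 0 < m p := lt_of_le_of_ne (h0 p) (Ne.symm hz)
    have h2 : m p ≤ m q := a1.trans (mul_le_of_le_one_right (h0 q) (h1 r))
    have h3 : m p * 1 ≤ m p * m r := by linarith
    have h4 : 1 ≤ m r := le_of_mul_le_mul_left h3 hpos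
    have h5 : m p * m q ≤ m p := mul_le_of_le_one_right (h0 p) (h1 q)
    linarith [h1 p]

theorem Represents.norm_adCoeff_half_le_one {u : U2} {g : SO3} (h : Represents u g) {a b : V}
    (hab : a = 0 ↔ b = 0) : ‖StabCode.adCoeff u a b‖ / 2 ≤ 1 := by
  by_cases ha : a = 0
  · rw [ha, hab.mp ha, adCoeff_zero_left, if_pos rfl]
    simp
  · obtain ⟨i, rfl⟩ := exists_axisVec_eq ha
    obtain ⟨j, rfl⟩ := exists_axisVec_eq (mt hab.mpr ha)
    rw [h.norm_adCoeff]
    linarith [g.abs_entry_le_one i j]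

variable {P : Type*} {L : Submodule (ZMod 2) (P → V)}

/-- `L` has two vectors which are supported on the pair `{p, q}` of qubits, and are nonzero and
distinct at either of them. -/
def IsBellPair (L : Submodule (ZMod 2) (P → V)) (p q : P) : Prop :=
  p ≠ q ∧ ∃ v₀ v₁ : L, (∀ r, r ≠ p → r ≠ q → v₀.1 r = 0 ∧ v₁.1 r = 0) ∧
    (v₀.1 p ≠ 0 ∧ v₁.1 p ≠ 0 ∧ v₀.1 p ≠ v₁.1 p) ∧ (v₀.1 q ≠ 0 ∧ v₁.1 q ≠ 0 ∧ v₀.1 q ≠ v₁.1 q)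

theorem IsBellPair.symm {p q : P} (h : IsBellPair L p q) : IsBellPair L q p := by
  obtain ⟨hpq, v₀, v₁, h0, h1, h2⟩ := h
  exact ⟨hpq.symm, v₀, v₁, fun r hr hr' => h0 r hr' hr, h2, h1⟩

theorem exists_ne_zero_of_not_splits (hzero : ¬SplitsOffZeroFactor L) (p : P) :
    ∃ v : L, v.1 p ≠ 0 := by
  by_contra! hcon
  refine hzero ⟨{p}, Set.singleton_nonempty p, ?_, ?_⟩
  · refine le_antisymm (le_trans (fun v hv => ?_) le_sup_right) (sup_le inf_le_left inf_le_left)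
    refine ⟨hv, fun q hq => ?_⟩
    rw [Set.mem_compl_iff, not_not, Set.mem_singleton_iff] at hq
    rw [hq]
    exact hcon ⟨v, hv⟩
  · rw [eq_bot_iff]
    rintro v ⟨hv, hs⟩
    rw [Submodule.mem_bot]
    funext q
    by_cases hq : q = p
    · rw [hq]
      exact hcon ⟨v, hv⟩
    · exact hs q hq

variable [Fintype P]

theorem exists_minimal_support (hzero : ¬SplitsOffZeroFactor L) (p : P) :
    ∃ v₀ : L, v₀.1 p ≠ 0 ∧ ∀ v : L, v.1 p ≠ 0 → (∀ q, v₀.1 q = 0 → v.1 q = 0) →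
      ∀ q, v.1 q = 0 ↔ v₀.1 q = 0 := by
  obtain ⟨v₀, hv₀, hmin⟩ := Set.exists_min_image {v : L | v.1 p ≠ 0}
    (fun v => (Finset.univ.filter fun q => v.1 q ≠ 0).card) (Set.toFinite _)
    (exists_ne_zero_of_not_splits hzero p)
  refine ⟨v₀, hv₀, fun v hv hsub q => ⟨fun hq => ?_, hsub q⟩⟩
  have hss : (Finset.univ.filter fun q => v.1 q ≠ 0) ⊆ Finset.univ.filter fun q => v₀.1 q ≠ 0 := by
    intro r hr
    simp only [Finset.mem_filter, Finset.mem_univ, true_and] at hr ⊢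
    exact mt (hsub r) hr
  have heq := Finset.eq_of_subset_of_card_le hss (hmin v hv)
  by_contra hne
  have : q ∈ Finset.univ.filter fun q => v.1 q ≠ 0 := by
    rw [heq]
    simpa using hne
  simp [hq] at this

variable [DecidableEq P]

/-- At each qubit, either the automorphisms of the code preserve a coordinate axis, or they are
integral, or the qubit belongs to a Bell pair. -/
theorem local_type (hL : IsIsotropic L) (hzero : ¬SplitsOffZeroFactor L) (σ : Sec L) (p : P) :
    (∃ i, ∀ g ∈ autGroup σ, g p ∈ axisStab i) ∨ (∀ g ∈ autGroup σ, g p ∈ integralSO3) ∨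
      ∃ q, IsBellPair L p q := by
  obtain ⟨v₀, hv₀, hmin⟩ := exists_minimal_support hzero p
  -- If `v₀ p` is the only nonzero value at `p` of vectors within the support of `v₀`, then `v₀` is
  -- isolated in the sense of `adCoeff_eq_zero_of_isolated` for every other value, and its row has
  -- no other nonzero entry.
  by_cases ha : ∀ v : L, v.1 p ≠ 0 → (∀ q, v₀.1 q = 0 → v.1 q = 0) → v.1 p = v₀.1 p
  · left
    obtain ⟨i, hi⟩ := exists_axisVec_eq hv₀
    refine ⟨i, ?_⟩
    rintro g ⟨u, hu, hpres⟩ j hj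
    have h0 := adCoeff_eq_zero_of_isolated σ hpres p v₀ (axisVec_ne_zero j)
      (fun v hvp hv => by
        have hvp' := ha v hvp fun q hq => by
          by_cases hqp : q = p
          · exact absurd (hqp ▸ hq) hv₀
          · rw [hv q hqp, hq]
        apply Subtype.ext
        funext q
        by_cases hqp : q = p
        · rw [hqp, hvp']
        · exact hv q hqp)
      (fun v hvp => by
        by_contra! hcon
        have := ha v (by rw [hvp]; exact axisVec_ne_zero j) fun q hq => by
          by_cases hqp : q = p
          · exact absurd (hqp ▸ hq) hv₀
          · exact (hcon q hqp).mpr hq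
        rw [hvp, ← hi] at this
        exact hj (axisVec_injective this))
    have hn := (hu p).norm_adCoeff i j
    rw [hi, h0, norm_zero] at hn
    exact abs_eq_zero.mp (by linarith)
  right
  push Not at ha
  obtain ⟨v₁, hv₁, hs₁, hne⟩ := ha
  -- With `0` added, `M` turns out to be a plane that projects isomorphically onto `V` at every
  -- qubit in the support of `v₀`.
  let M : L → Prop := fun v => v.1 p ≠ 0 ∧ ∀ q, v₀.1 q = 0 → v.1 q = 0
  have hM₀ : M v₀ := ⟨hv₀, fun _ h => h⟩
  have hM₁ : M v₁ := ⟨hv₁, hs₁⟩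
  have hMz : ∀ {v}, M v → ∀ q, v.1 q = 0 ↔ v₀.1 q = 0 := fun hv => hmin _ hv.1 hv.2
  have hMadd : ∀ {v w : L}, M v → M w → v.1 p ≠ w.1 p → M (v + w) := by
    intro v w hv hw hvw
    refine ⟨fun h => hvw (V.add_eq_zero_iff.mp h), fun q hq => ?_⟩
    change v.1 q + w.1 q = 0
    rw [hv.2 q hq, hw.2 q hq, add_zero]
  -- Otherwise `v + w` would belong to `M` and yet vanish at `q`, against the minimality of the
  -- support.
  have hdist : ∀ {v w : L}, M v → M w → v.1 p ≠ w.1 p → ∀ q, v₀.1 q ≠ 0 → v.1 q ≠ w.1 q := by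
    intro v w hv hw hvw q hq h
    exact hq ((hMz (hMadd hv hw hvw) q).mp (V.add_eq_zero_iff.mpr h))
  -- Take `x` in `M` with another value at `p`. At each qubit of the support, `w` is nonzero and
  -- differs from `x` and from `x + v`; only the value of `v` remains.
  have hinj : ∀ {v w : L}, M v → M w → v.1 p = w.1 p → v = w := by
    intro v w hv hw hvw
    obtain ⟨x, hx, hxv⟩ : ∃ x, M x ∧ v.1 p ≠ x.1 p := by
      by_cases h : v.1 p = v₀.1 p
      · exact ⟨v₁, hM₁, fun h' => hne (h'.symm.trans h)⟩
      · exact ⟨v₀, hM₀, h⟩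
    apply Subtype.ext
    funext q
    by_cases hq : v₀.1 q = 0
    · rw [hv.2 q hq, hw.2 q hq]
    · refine V.eq_of_third (b := x.1 q) (mt (hMz hv q).mp hq) (mt (hMz hx q).mp hq)
        (mt (hMz hw q).mp hq) (hdist hv hx hxv q hq) (hdist hw hx (hvw ▸ hxv) q hq)
        (hdist (hMadd hx hv hxv.symm) hw (fun h => hx.1 ?_) q hq)
      have h' : x.1 p + v.1 p = w.1 p := h
      rw [hvw] at h'
      simpa using h'
  -- If `v` vanished at `p`, then `v + v₀` and `v₀` would agree at `p`, so `v = 0` by injectivity.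
  -- Hence `M` does not depend on which qubit of the support defines it.
  have hMof : ∀ {v : L} (r : P), v.1 r ≠ 0 → (∀ q, v₀.1 q = 0 → v.1 q = 0) → M v := by
    intro v r hr hs
    refine ⟨fun hvp => hr ?_, hs⟩
    have h1 : (v + v₀).1 p = v₀.1 p := by
      change v.1 p + v₀.1 p = v₀.1 p
      rw [hvp, zero_add]
    have h2 : M (v + v₀) := ⟨h1 ▸ hv₀, fun q hq => by
      change v.1 q + v₀.1 q = 0
      rw [hs q hq, hq, add_zero]⟩
    have h3 : v = 0 := by simpa using hinj h2 hM₀ h1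
    rw [h3]
    rfl
  have hsurj : ∀ a : V, a ≠ 0 → ∃ v, M v ∧ v.1 p = a := by
    intro a ha
    rcases V.cases_of_ne hv₀ hv₁ hne.symm ha with h | h | h
    · exact ⟨v₀, hM₀, h.symm⟩
    · exact ⟨v₁, hM₁, h.symm⟩
    · exact ⟨v₀ + v₁, hMadd hM₀ hM₁ hne.symm, h.symm⟩
  have heqp : ∀ {v w : L}, M v → M w → ∀ s, v₀.1 s ≠ 0 → v.1 s = w.1 s → v = w := by
    intro v w hv hw s hs h
    refine hinj hv hw ?_
    by_contra hcon
    exact hdist hv hw hcon s hs h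
  -- If the support were `{p}`, then `omega v₀ v₁` would be the form of two distinct nonzero vectors
  -- of `V`, which is `1`.
  have hq : ∃ q, q ≠ p ∧ v₀.1 q ≠ 0 := by
    by_contra! hcon
    have h1 := hL v₀.1 v₀.2 v₁.1 v₁.2
    rw [omega, Finset.sum_eq_single p (fun q _ hq => by rw [hcon q hq]; simp) (by simp)] at h1
    have h2 := form_eq_one_of_ne hv₀ hv₁ hne.symm
    rw [form, h1] at h2
    exact zero_ne_one h2
  obtain ⟨q, hqp, hq⟩ := hq
  by_cases hr : ∃ r, r ≠ p ∧ r ≠ q ∧ v₀.1 r ≠ 0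
  · left
    obtain ⟨r, hrp, hrq, hr⟩ := hr
    rintro g ⟨u, hu, hpres⟩
    refine mem_integralSO3_of_off_diag fun i j hij => ?_
    obtain ⟨va, hva, hai⟩ := hsurj _ (axisVec_ne_zero i)
    obtain ⟨vb, hvb, hbj⟩ := hsurj _ (axisVec_ne_zero j)
    -- The second qubit `t` of the support lets agreement away from `s` determine a vector of `M`,
    -- as `norm_adCoeff_eq_prod` requires.
    have hprod : ∀ s t : P, s ≠ t → v₀.1 s ≠ 0 → v₀.1 t ≠ 0 →
        ‖adCoeff (u s) (va.1 s) (vb.1 s)‖ / 2 =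
          ∏ x ∈ Finset.univ.erase s, (‖adCoeff (u x) (va.1 x) (vb.1 x)‖ / 2) := by
      intro s t hst hs ht
      refine norm_adCoeff_eq_prod σ hpres s va vb (mt (hMz hvb s).mp hs) ?_ ?_
      · intro v hvs hv
        refine heqp (hMof s hvs fun x hx => ?_) hva t ht (hv t hst.symm)
        rw [hv x fun h => hs (h ▸ hx)]
        exact hva.2 x hx
      · intro v hvs hv
        refine heqp (hMof s ?_ fun x hx => ?_) hvb s hs hvs
        · rw [hvs]
          exact mt (hMz hvb s).mp hs
        · exact (hv x fun h => hs (h ▸ hx)).mpr (hva.2 x hx)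
    have hfin := eq_zero_or_one_of_eq_prod_erase
      (fun x => ‖adCoeff (u x) (va.1 x) (vb.1 x)‖ / 2) (fun x => by positivity)
      (fun x => (hu x).norm_adCoeff_half_le_one ((hMz hva x).trans (hMz hvb x).symm))
      hqp.symm hrp.symm hrq.symm (hprod p q hqp.symm hv₀ hq) (hprod q p hqp hq hv₀)
      (hprod r p hrp hr hv₀)
    simp only [hai, hbj, (hu p).norm_adCoeff] at hfin
    rcases hfin with h | h
    · left; linarith
    · right; linarith
  · right
    push Not at hr
    refine ⟨q, hqp.symm, v₀, v₁, fun r h1 h2 => ?_, ⟨hv₀, hv₁, hne.symm⟩, hq,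
      mt (hMz hM₁ q).mp hq, hdist hM₀ hM₁ hne.symm q hq⟩
    have := hr r h1 h2
    exact ⟨this, hs₁ r this⟩

end LocalTypes

/-! ### Removing Bell pairs -/

section BellPairs

open Matrix

/-- The forms with a base determine the coordinates of a vector, so the equations say that `a` has
the same coordinates in `x₀, x₁` as `b` in `y₀, y₁`. Thus the plane of a Bell pair contains its
orthogonal complement in `V ⊕ V`. -/
theorem V.pair_mem_of_form_eq_zero {x₀ x₁ y₀ y₁ a b : V} (hx₀ : x₀ ≠ 0) (hx₁ : x₁ ≠ 0)
    (hx : x₀ ≠ x₁) (hy₀ : y₀ ≠ 0) (hy₁ : y₁ ≠ 0) (hy : y₀ ≠ y₁)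
    (h₀ : form x₀ a + form y₀ b = 0) (h₁ : form x₁ a + form y₁ b = 0) :
    (a = 0 ∧ b = 0) ∨ (a = x₀ ∧ b = y₀) ∨ (a = x₁ ∧ b = y₁) ∨ (a = x₀ + x₁ ∧ b = y₀ + y₁) := by
  have hspan : ∀ c d e : V, c ≠ 0 ∧ d ≠ 0 ∧ c ≠ d →
      (form c e = 0 ∧ form d e = 0 ∧ e = 0) ∨ (form c e = 0 ∧ form d e = 1 ∧ e = c) ∨
      (form c e = 1 ∧ form d e = 0 ∧ e = d) ∨ (form c e = 1 ∧ form d e = 1 ∧ e = c + d) := by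
    decide
  have h01 : (0 : ZMod 2) + 1 ≠ 0 := by decide
  have h10 : (1 : ZMod 2) + 0 ≠ 0 := by decide
  obtain ⟨e₀, e₁, e⟩ | ⟨e₀, e₁, e⟩ | ⟨e₀, e₁, e⟩ | ⟨e₀, e₁, e⟩ := hspan x₀ x₁ a ⟨hx₀, hx₁, hx⟩ <;>
    obtain ⟨f₀, f₁, f⟩ | ⟨f₀, f₁, f⟩ | ⟨f₀, f₁, f⟩ | ⟨f₀, f₁, f⟩ :=
      hspan y₀ y₁ b ⟨hy₀, hy₁, hy⟩ <;>
    rw [e₀, f₀] at h₀ <;> rw [e₁, f₁] at h₁ <;>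
    first
    | exact absurd h₀ h01
    | exact absurd h₀ h10
    | exact absurd h₁ h01
    | exact absurd h₁ h10
    | exact Or.inl ⟨e, f⟩
    | exact Or.inr (Or.inl ⟨e, f⟩)
    | exact Or.inr (Or.inr (Or.inl ⟨e, f⟩))
    | exact Or.inr (Or.inr (Or.inr ⟨e, f⟩))

theorem mulVec_one_add_mul_one_add {n : Type*} [Fintype n] [DecidableEq n] {S T : Matrix n n ℂ}
    {x : n → ℂ} (hS : S *ᵥ x = x) (hT : T *ᵥ x = x) :
    ((1 + S) * (1 + T)) *ᵥ x = (4 : ℂ) • x := by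
  have hT' : (1 + T) *ᵥ x = (2 : ℂ) • x := by rw [add_mulVec, one_mulVec, hT, two_smul]
  rw [← mulVec_mulVec, hT', mulVec_smul, add_mulVec, one_mulVec, hS, ← two_smul ℂ x, smul_smul]
  norm_num

variable {P : Type*} [Fintype P] [DecidableEq P] {L : Submodule (ZMod 2) (P → V)} (σ : Sec L)

theorem pauliTensor_eq_smul_stabMat (v : L) :
    pauliTensor v.1 = (stabPhase σ v)⁻¹ • stabMat σ v := by
  rw [stabMat_eq, smul_smul, inv_mul_cancel₀ (stabPhase_ne_zero σ v), one_smul]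

theorem stabMat_mul_comm (v w : L) : stabMat σ v * stabMat σ w = stabMat σ w * stabMat σ v := by
  rw [← stabMat_add, ← stabMat_add, add_comm]

theorem mulVec_anticomm {v : L} {w : P → V} (h : omega v.1 w = 1) {x : (P → Fin 2) → ℂ}
    (hx : stabMat σ v *ᵥ x = x) : (1 + stabMat σ v) *ᵥ (pauliTensor w *ᵥ x) = 0 := by
  have h1 : stabMat σ v * pauliTensor w = -(pauliTensor w * stabMat σ v) := by
    rw [stabMat_eq, smul_mul_assoc, pauliTensor_mul_comm, h, sgn_one, mul_smul_comm, neg_smul,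
      one_smul, smul_neg]
  rw [add_mulVec, one_mulVec, mulVec_mulVec, h1, neg_mulVec, ← mulVec_mulVec, hx, add_neg_cancel]

/-- An operator on a Bell pair, compressed to the space that is fixed by the stabilizers of the
pair, is a scalar. -/
theorem exists_bell_scalar {p q : P} (hpq : p ≠ q) (v₀ v₁ : L)
    (hoff : ∀ r, r ≠ p → r ≠ q → v₀.1 r = 0 ∧ v₁.1 r = 0)
    (hp : v₀.1 p ≠ 0 ∧ v₁.1 p ≠ 0 ∧ v₀.1 p ≠ v₁.1 p)
    (hq : v₀.1 q ≠ 0 ∧ v₁.1 q ≠ 0 ∧ v₀.1 q ≠ v₁.1 q)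
    (M : P → Matrix (Fin 2) (Fin 2) ℂ) (hM : ∀ r, r ≠ p → r ≠ q → M r = 1) :
    ∃ c : ℂ, ∀ x, stabMat σ v₀ *ᵥ x = x → stabMat σ v₁ *ᵥ x = x →
      ((1 + stabMat σ v₀) * (1 + stabMat σ v₁)) *ᵥ (tensorMat M *ᵥ x) = c • x := by
  set Q := (1 + stabMat σ v₀) * (1 + stabMat σ v₁) with hQ
  -- Both orders are needed, so that the factor which kills a given Pauli operator can be applied
  -- first.
  have hQ' : Q = (1 + stabMat σ v₁) * (1 + stabMat σ v₀) := by
    rw [hQ, add_mul, add_mul, mul_add, mul_add, mul_add, mul_add, stabMat_mul_comm]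
    simp only [one_mul, mul_one]
    abel
  have homega : ∀ w : P → V, (∀ r, r ≠ p → r ≠ q → w r = 0) → ∀ v : P → V,
      omega v w = form (v p) (w p) + form (v q) (w q) := by
    intro w hw v
    rw [omega, Finset.sum_eq_add p q hpq]
    · rfl
    · intro r _ hr
      simp [hw r hr.1 hr.2]
    · simp
    · simp
  -- A Pauli operator on the pair that anticommutes with one of the two stabilizers is killed by
  -- `Q`; one that commutes with both is itself a multiple of a stabilizer. All other Pauli
  -- operators have coefficient `0`, as `M` is trivial off the pair.
  have hterm : ∀ w : P → V, ∃ c : ℂ, ∀ x, stabMat σ v₀ *ᵥ x = x → stabMat σ v₁ *ᵥ x = x →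
      Q *ᵥ (((∏ r, (star (pauliOf (w r)) * M r).trace / 2) • pauliTensor w) *ᵥ x) = c • x := by
    intro w
    by_cases hw : ∀ r, r ≠ p → r ≠ q → w r = 0
    · have hbit : ∀ a : ZMod 2, a ≠ 0 → a = 1 := by decide
      by_cases h0 : omega v₀.1 w = 0
      · by_cases h1 : omega v₁.1 w = 0
        · suffices hv : ∃ v : L, w = v.1 ∧
              ∀ x, stabMat σ v₀ *ᵥ x = x → stabMat σ v₁ *ᵥ x = x → stabMat σ v *ᵥ x = x by
            obtain ⟨v, rfl, hv⟩ := hv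
            refine ⟨(∏ r, (star (pauliOf (v.1 r)) * M r).trace / 2) * ((stabPhase σ v)⁻¹ * 4),
              fun x hx0 hx1 => ?_⟩
            rw [pauliTensor_eq_smul_stabMat σ v, smul_mulVec, smul_mulVec, hv x hx0 hx1,
              mulVec_smul, mulVec_smul, hQ, mulVec_one_add_mul_one_add hx0 hx1, smul_smul, smul_smul,
              mul_assoc]
          have hext : ∀ v : P → V, (∀ r, r ≠ p → r ≠ q → v r = 0) → w p = v p → w q = v q →
              w = v := by
            intro v hv h1 h2
            funext r
            by_cases hrp : r = p
            · rw [hrp, h1]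
            · by_cases hrq : r = q
              · rw [hrq, h2]
              · rw [hw r hrp hrq, hv r hrp hrq]
          rw [homega w hw] at h0 h1
          rcases V.pair_mem_of_form_eq_zero hp.1 hp.2.1 hp.2.2 hq.1 hq.2.1 hq.2.2 h0 h1 with
            h | h | h | h
          · exact ⟨0, hext _ (fun _ _ _ => rfl) h.1 h.2, fun x _ _ => by
              rw [stabMat_zero, one_mulVec]⟩
          · exact ⟨v₀, hext _ (fun r h1 h2 => (hoff r h1 h2).1) h.1 h.2, fun x hx _ => hx⟩
          · exact ⟨v₁, hext _ (fun r h1 h2 => (hoff r h1 h2).2) h.1 h.2, fun x _ hx => hx⟩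
          · refine ⟨v₀ + v₁, hext _ (fun r h1 h2 => ?_) h.1 h.2, fun x hx0 hx1 => ?_⟩
            · change v₀.1 r + v₁.1 r = 0
              rw [(hoff r h1 h2).1, (hoff r h1 h2).2, add_zero]
            · rw [stabMat_add, ← mulVec_mulVec, hx1, hx0]
        · refine ⟨0, fun x _ hx1 => ?_⟩
          rw [smul_mulVec, mulVec_smul, hQ, ← mulVec_mulVec, mulVec_anticomm σ (hbit _ h1) hx1,
            mulVec_zero, smul_zero, zero_smul]
      · refine ⟨0, fun x hx0 _ => ?_⟩
        rw [smul_mulVec, mulVec_smul, hQ', ← mulVec_mulVec, mulVec_anticomm σ (hbit _ h0) hx0,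
          mulVec_zero, smul_zero, zero_smul]
    · push Not at hw
      obtain ⟨r, hrp, hrq, hwr⟩ := hw
      refine ⟨0, fun x _ _ => ?_⟩
      have h0 : (star (pauliOf (w r)) * M r).trace / 2 = 0 := by
        have := trace_star_pauliOf_mul (w r) 0
        rw [pauliOf_zero, if_neg hwr] at this
        rw [hM r hrp hrq, this, zero_div]
      rw [Finset.prod_eq_zero (Finset.mem_univ r) h0, zero_smul, zero_mulVec, mulVec_zero,
        zero_smul]
  choose c hc using hterm
  refine ⟨∑ w, c w, fun x hx0 hx1 => ?_⟩
  rw [tensorMat_eq_sum_pauliTensor, sum_mulVec, mulVec_sum, Finset.sum_smul]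
  exact Finset.sum_congr rfl fun w _ => hc w x hx0 hx1

/-- On the code, the action of an automorphism on a Bell pair is a scalar. -/
theorem IsBellPair.exists_eq_smul {p q : P} (h : IsBellPair L p q) {u : P → U2}
    (hpres : ∀ ψ ∈ code σ, act (tensorU u) ψ ∈ code σ) :
    ∃ c : ℂ, c ≠ 0 ∧ ∀ ψ ∈ code σ, act (tensorU u) ψ =
      c • act (tensorU (Function.update (Function.update u p 1) q 1)) ψ := by
  obtain ⟨hpq, v₀, v₁, hoff, hp, hq⟩ := h
  set u' := Function.update (Function.update u p 1) q 1 with hu'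
  let m : P → U2 := fun r => if r = p ∨ r = q then u r else 1
  have hu'p : u' p = 1 := by rw [hu', Function.update_of_ne hpq, Function.update_self]
  have hu'q : u' q = 1 := by rw [hu', Function.update_self]
  have hu'r : ∀ r, r ≠ p → r ≠ q → u' r = u r := fun r h1 h2 => by
    rw [hu', Function.update_of_ne h2, Function.update_of_ne h1]
  have hmu : m * u' = u := by
    funext r
    change m r * u' r = u r
    by_cases hrp : r = p
    · subst hrp
      simp [m, hu'p]
    · by_cases hrq : r = q
      · subst hrq
        simp [m, hu'q]
      · simp [m, hrp, hrq, hu'r r hrp hrq]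
  obtain ⟨c, hc⟩ := exists_bell_scalar σ hpq v₀ v₁ hoff hp hq (fun r => (m r).1)
    (fun r h1 h2 => by simp [m, h1, h2])
  have hcomm : ∀ v : L, (∀ r, r ≠ p → r ≠ q → v.1 r = 0) →
      stabMat σ v * (tensorU u').1 = (tensorU u').1 * stabMat σ v := by
    intro v hv
    rw [stabMat_eq, smul_mul_assoc, mul_smul_comm, coe_tensorU, pauliTensor, ← tensorMat_mul,
      ← tensorMat_mul]
    congr 2
    funext r
    change pauliOf (v.1 r) * (u' r).1 = (u' r).1 * pauliOf (v.1 r)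
    by_cases hrp : r = p
    · rw [hrp, hu'p]
      simp
    · by_cases hrq : r = q
      · rw [hrq, hu'q]
        simp
      · rw [hv r hrp hrq, pauliOf_zero, one_mul, mul_one]
  -- The product of the two factors `1 + S` multiplies the image of `ψ` under `u` by `4`, since this
  -- image is in the code. The image under `u'` need not be in the code, but the stabilizers of the
  -- pair still fix it, so `hc` applies to the remaining part `m`.
  have key : ∀ ψ ∈ code σ, act (tensorU u) ψ = (c / 4) • act (tensorU u') ψ := by
    intro ψ hψ
    have hψ' := (mem_code_iff σ).mp hψ
    have hU := (mem_code_iff σ).mp (hpres ψ hψ)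
    have hfix : ∀ v : L, (∀ r, r ≠ p → r ≠ q → v.1 r = 0) →
        stabMat σ v *ᵥ ((tensorU u').1 *ᵥ ψ.ofLp) = (tensorU u').1 *ᵥ ψ.ofLp := by
      intro v hv
      rw [mulVec_mulVec, hcomm v hv, ← mulVec_mulVec, hψ' v]
    have h1 := hc _ (hfix v₀ fun r h1 h2 => (hoff r h1 h2).1)
      (hfix v₁ fun r h1 h2 => (hoff r h1 h2).2)
    have h2 : (tensorMat fun r => (m r).1) *ᵥ ((tensorU u').1 *ᵥ ψ.ofLp) =
        (act (tensorU u) ψ).ofLp := by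
      rw [ofLp_act, ← hmu, map_mul, mulVec_mulVec]
      rfl
    rw [h2, mulVec_one_add_mul_one_add (hU v₀) (hU v₁)] at h1
    apply WithLp.ofLp_injective 2
    have h3 : (act (tensorU u) ψ).ofLp = (1 / 4 : ℂ) • ((4 : ℂ) • (act (tensorU u) ψ).ofLp) := by
      rw [smul_smul]
      norm_num
    rw [h3, h1, smul_smul, WithLp.ofLp_smul, ofLp_act]
    congr 1
    ring
  by_cases hbot : ∀ ψ ∈ code σ, ψ = 0
  -- On a zero code any nonzero scalar will do; otherwise `c / 4 = 0` would contradict the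
  -- invertibility of `u`.
  · refine ⟨1, one_ne_zero, fun ψ hψ => ?_⟩
    rw [hbot ψ hψ, map_zero, map_zero, smul_zero]
  · push Not at hbot
    obtain ⟨ψ, hψ, hne⟩ := hbot
    refine ⟨c / 4, fun h0 => hne ?_, key⟩
    have := key ψ hψ
    rw [h0, zero_smul] at this
    rw [← act_inv_act (tensorU u) ψ, this, map_zero]

variable {σ} in
/-- All Bell pairs can be dropped from an automorphism without affecting its class. -/
theorem exists_eq_one_on_bellPairs {u : P → U2}
    (hpres : ∀ ψ ∈ code σ, act (tensorU u) ψ ∈ code σ) (F : Finset P)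
    (hF : ∀ p ∈ F, ∃ q, IsBellPair L p q) :
    ∃ u' : P → U2, (∀ p, u' p = u p ∨ (u' p = 1 ∧ ∃ q, IsBellPair L p q)) ∧
      (∀ p ∈ F, u' p = 1) ∧ (∀ ψ ∈ code σ, act (tensorU u') ψ ∈ code σ) ∧
      ∃ c : ℂ, c ≠ 0 ∧ ∀ ψ ∈ code σ, act (tensorU u) ψ = c • act (tensorU u') ψ := by
  induction F using Finset.induction_on with
  | empty =>
    exact ⟨u, fun p => Or.inl rfl, by simp, hpres, 1, one_ne_zero, fun ψ _ => (one_smul _ _).symm⟩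
  | insert p F _ ih =>
    obtain ⟨u', h1, h2, h3, c, hc, h4⟩ := ih fun p hp => hF p (Finset.mem_insert_of_mem hp)
    obtain ⟨q, hq⟩ := hF p (Finset.mem_insert_self p F)
    obtain ⟨d, hd, h5⟩ := hq.exists_eq_smul σ h3
    refine ⟨Function.update (Function.update u' p 1) q 1, ?_, ?_, ?_, c * d, mul_ne_zero hc hd, ?_⟩
    · intro r
      by_cases hrq : r = q
      · subst hrq
        exact Or.inr ⟨Function.update_self .., p, hq.symm⟩
      · rw [Function.update_of_ne hrq]
        by_cases hrp : r = p
        · subst hrp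
          exact Or.inr ⟨Function.update_self .., q, hq⟩
        · rw [Function.update_of_ne hrp]
          exact h1 r
    · intro r hr
      by_cases hrq : r = q
      · subst hrq
        exact Function.update_self ..
      · rw [Function.update_of_ne hrq]
        by_cases hrp : r = p
        · subst hrp
          exact Function.update_self ..
        · rw [Function.update_of_ne hrp]
          exact h2 r ((Finset.mem_insert.mp hr).resolve_left hrp)
    · intro ψ hψ
      have h6 : act (tensorU (Function.update (Function.update u' p 1) q 1)) ψ =
          d⁻¹ • act (tensorU u') ψ := by
        rw [h5 ψ hψ, smul_smul, inv_mul_cancel₀ hd, one_smul]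
      rw [h6]
      exact (code σ).smul_mem _ (h3 ψ hψ)
    · intro ψ hψ
      rw [h4 ψ hψ, h5 ψ hψ, smul_smul]

/-- Each logical operator is represented by an automorphism which is trivial on all Bell pairs. -/
theorem exists_reduced_representative (g : autGroup σ) :
    ∃ g' : autGroup σ, (∀ p, (∃ q, IsBellPair L p q) → g'.1 p = 1) ∧
      (∀ p, (¬∃ q, IsBellPair L p q) → g'.1 p = g.1 p) ∧
      (QuotientGroup.mk g' : LogicalGroup σ) = QuotientGroup.mk g := by
  classical
  obtain ⟨u, hu, hpres⟩ := g.2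
  obtain ⟨u', h1, h2, h3, c, hc, h4⟩ := exists_eq_one_on_bellPairs hpres
    (Finset.univ.filter fun p => ∃ q, IsBellPair L p q) (by simp)
  let g' : P → SO3 := fun p => if ∃ q, IsBellPair L p q then 1 else g.1 p
  have hrep : ∀ p, Represents (u' p) (g' p) := by
    intro p
    by_cases hp : ∃ q, IsBellPair L p q
    · rw [h2 p (by simpa using hp)]
      simp only [g', if_pos hp]
      exact Represents.one
    · simp only [g', if_neg hp]
      rw [(h1 p).resolve_right fun h => hp h.2]
      exact hu p
  refine ⟨⟨g', u', hrep, h3⟩, fun p hp => if_pos hp, fun p hp => if_neg hp, ?_⟩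
  rw [QuotientGroup.eq]
  refine ⟨u'⁻¹ * u, fun p => (hrep p).inv.mul (hu p), c, fun ψ hψ => ?_⟩
  rw [map_mul, map_inv, act_mul, LinearMap.comp_apply, h4 ψ hψ, map_smul, act_inv_act]

end BellPairs

/-! ### Solvability of the logical group -/

section Solvable

theorem isSolvable_of_jointly_injective {G ι : Type*} [Group G] [Finite ι] {H : ι → Type*}
    [∀ i, Group (H i)] [∀ i, Group.IsSolvable (H i)] (f : ∀ i, G →* H i)
    (hf : ∀ x, (∀ i, f i x = 1) → x = 1) : Group.IsSolvable G := by
  have := Fintype.ofFinite ι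
  choose n hn using fun i => (inferInstance : Group.IsSolvable (H i)).solvable
  refine ⟨⟨∑ i, n i, ?_⟩⟩
  rw [eq_bot_iff]
  intro x hx
  rw [Subgroup.mem_bot]
  refine hf x fun i => ?_
  have h1 : f i x ∈ derivedSeries (H i) (∑ i, n i) :=
    map_derivedSeries_le_derivedSeries (f i) _ (Subgroup.mem_map_of_mem _ hx)
  have h2 := derivedSeries_antitone (H i)
    (Finset.single_le_sum (f := n) (fun _ _ => Nat.zero_le _) (Finset.mem_univ i)) h1
  rwa [hn i, Subgroup.mem_bot] at h2

variable {P : Type*} [Fintype P] [DecidableEq P] {L : Submodule (ZMod 2) (P → V)}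

/-- The group `B` of automorphisms that are trivial on all Bell pairs embeds into a product over the
qubits of solvable groups, by `local_type`, and it still maps onto the logical group, by
`exists_reduced_representative`. -/
theorem isSolvable_logicalGroup (hL : IsIsotropic L) (hzero : ¬SplitsOffZeroFactor L)
    (σ : Sec L) : Group.IsSolvable (LogicalGroup σ) := by
  let B : Subgroup (autGroup σ) :=
    { carrier := {g | ∀ p, (∃ q, IsBellPair L p q) → g.1 p = 1}
      one_mem' := fun _ _ => rfl
      mul_mem' := fun {g h} hg hh p hp => by
        change g.1 p * h.1 p = 1
        rw [hg p hp, hh p hp, one_mul]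
      inv_mem' := fun {g} hg p hp => by
        change (g.1 p)⁻¹ = 1
        rw [hg p hp, inv_one] }
  have hloc : ∀ p, ∃ H : Subgroup SO3, Group.IsSolvable H ∧ ∀ g : B, g.1.1 p ∈ H := by
    intro p
    rcases local_type hL hzero σ p with ⟨i, hi⟩ | hi | hi
    · exact ⟨axisStab i, inferInstance, fun g => hi _ g.1.2⟩
    · exact ⟨integralSO3, inferInstance, fun g => hi _ g.1.2⟩
    · exact ⟨⊥, inferInstance, fun g => Subgroup.mem_bot.mpr (g.2 p hi)⟩
  choose H hH hmem using hloc
  let f : ∀ p, B →* H p := fun p =>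
    { toFun := fun g => ⟨g.1.1 p, hmem p g⟩
      map_one' := rfl
      map_mul' := fun _ _ => rfl }
  have : Group.IsSolvable B := by
    refine isSolvable_of_jointly_injective f fun x hx => ?_
    apply Subtype.ext
    apply Subtype.ext
    funext p
    exact congrArg Subtype.val (hx p)
  refine Group.isSolvable_of_surjective (f := (QuotientGroup.mk' (scalarGroup σ)).comp B.subtype) ?_
  intro x
  obtain ⟨g, rfl⟩ := QuotientGroup.mk_surjective x
  obtain ⟨g', h1, -, h3⟩ := exists_reduced_representative σ g
  exact ⟨⟨g', h1⟩, h3⟩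

end Solvable

/-! ### Closedness and compactness -/

section Compact

open Matrix Topology

theorem isClosed_represents {P : Type*} :
    IsClosed {x : (P → U2) × (P → SO3) | ∀ p, Represents (x.1 p) (x.2 p)} := by
  simp only [Represents, Set.ofPred_forall]
  refine isClosed_iInter fun p => isClosed_iInter fun j => isClosed_eq ?_ ?_
  · have h1 : Continuous fun x : (P → U2) × (P → SO3) => (x.1 p).1 :=
      continuous_subtype_val.comp ((continuous_apply p).comp continuous_fst)
    exact (h1.mul continuous_const).mul h1.star
  · refine continuous_finsetSum _ fun i _ => ?_
    have h1 : Continuous fun x : (P → U2) × (P → SO3) => (((x.2 p).1 i j : ℝ) : ℂ) :=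
      Complex.continuous_ofReal.comp
        ((continuous_SO3_entry i j).comp ((continuous_apply p).comp continuous_snd))
    exact h1.smul continuous_const

variable {P : Type*} [Fintype P] [DecidableEq P] {L : Submodule (ZMod 2) (P → V)} (σ : Sec L)

theorem continuous_act_tensorU (ψ : StateSpace P) :
    Continuous fun u : P → U2 => act (tensorU u) ψ := by
  have h1 : Continuous fun u : P → U2 => (tensorU u).1 *ᵥ ψ.ofLp := by
    refine Continuous.matrix_mulVec ?_ continuous_const
    simp only [coe_tensorU, tensorMat]
    refine continuous_matrix fun a b => ?_
    simp only [of_apply]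
    refine continuous_finsetProd _ fun p _ => ?_
    exact (continuous_subtype_val.comp (continuous_apply p)).matrix_elem _ _
  exact (PiLp.continuous_toLp 2 _).comp h1

/-- The choice of `u` is eliminated by projecting along the compact factor U(2)^P, and such a
projection is a closed map. -/
theorem isClosed_autGroup : IsClosed (autGroup σ : Set (P → SO3)) := by
  have hpres : IsClosed {x : (P → U2) × (P → SO3) |
      ∀ ψ ∈ code σ, act (tensorU x.1) ψ ∈ code σ} := by
    simp only [Set.ofPred_forall]
    refine isClosed_iInter fun ψ => isClosed_iInter fun _ => ?_
    exact (code σ).closed_of_finiteDimensional.preimage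
      ((continuous_act_tensorU ψ).comp continuous_fst)
  have h := isClosedMap_snd_of_compactSpace _ (isClosed_represents.inter hpres)
  convert h using 1
  ext g
  exact ⟨fun ⟨u, h1, h2⟩ => ⟨(u, g), ⟨h1, h2⟩, rfl⟩, fun ⟨x, ⟨h1, h2⟩, h3⟩ => h3 ▸ ⟨x.1, h1, h2⟩⟩

/-- This trades the unknown scalar for equations in `U`, which visibly define a closed set. -/
theorem exists_scalar_iff (U : StateSpace P →ₗ[ℂ] StateSpace P) (C : Submodule ℂ (StateSpace P)) :
    (∃ c : ℂ, ∀ ψ ∈ C, U ψ = c • ψ) ↔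
      ∀ ψ ∈ C, ∀ χ ∈ C, ∀ a b, U ψ a * χ b = ψ a * U χ b := by
  constructor
  · rintro ⟨c, hc⟩ ψ hψ χ hχ a b
    rw [hc ψ hψ, hc χ hχ]
    simp only [PiLp.smul_apply, smul_eq_mul]
    ring
  · intro h
    by_cases hbot : ∀ ψ ∈ C, ψ = 0
    · refine ⟨0, fun ψ hψ => ?_⟩
      rw [hbot ψ hψ, map_zero, smul_zero]
    · push Not at hbot
      obtain ⟨χ, hχ, hne⟩ := hbot
      obtain ⟨b, hb⟩ : ∃ b, χ b ≠ 0 := by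
        by_contra! hcon
        exact hne (by ext b; exact hcon b)
      refine ⟨U χ b / χ b, fun ψ hψ => ?_⟩
      ext a
      have := h ψ hψ χ hχ a b
      simp only [PiLp.smul_apply, smul_eq_mul]
      field_simp
      linear_combination this

theorem isClosed_scalarGroup : IsClosed (scalarGroup σ : Set (autGroup σ)) := by
  have hscal : IsClosed {x : (P → U2) × (P → SO3) |
      ∀ ψ ∈ code σ, ∀ χ ∈ code σ, ∀ a b,
        act (tensorU x.1) ψ a * χ b = ψ a * act (tensorU x.1) χ b} := by
    have hc : ∀ (ψ : StateSpace P) (a : P → Fin 2),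
        Continuous fun x : (P → U2) × (P → SO3) => act (tensorU x.1) ψ a := fun ψ a =>
      (PiLp.continuous_apply 2 _ a).comp ((continuous_act_tensorU ψ).comp continuous_fst)
    simp only [Set.ofPred_forall]
    refine isClosed_iInter fun ψ => isClosed_iInter fun _ => isClosed_iInter fun χ =>
      isClosed_iInter fun _ => isClosed_iInter fun a => isClosed_iInter fun b => ?_
    exact isClosed_eq ((hc ψ a).mul continuous_const) (continuous_const.mul (hc χ b))
  have h := isClosedMap_snd_of_compactSpace _ (isClosed_represents.inter hscal)
  convert h.preimage (continuous_subtype_val (p := fun g => g ∈ autGroup σ)) using 1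
  ext g
  constructor
  · rintro ⟨u, h1, h2⟩
    exact ⟨(u, g.1), ⟨h1, (exists_scalar_iff _ _).mp h2⟩, rfl⟩
  · rintro ⟨x, ⟨h1, h2⟩, h3⟩
    refine ⟨x.1, fun p => ?_, (exists_scalar_iff _ _).mpr h2⟩
    rw [← h3]
    exact h1 p

theorem compactSpace_autGroup : CompactSpace (autGroup σ) :=
  isCompact_iff_compactSpace.mp (isClosed_autGroup σ).isCompact

theorem t2Space_logicalGroup : T2Space (LogicalGroup σ) := by
  have := isClosed_scalarGroup σ
  infer_instance

end Compact

/-! ### The Lie group structure -/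

section Lie

open Matrix Topology Filter

variable {P : Type*} [Fintype P] [DecidableEq P] {L : Submodule (ZMod 2) (P → V)} (σ : Sec L)

/-- The product of the rotations by the angles `θ p` about the axes `ax p`. -/
def torusHom {P : Type*} (ax : P → Fin 3) (θ : P → ℝ) : P → SO3 := fun p => rot (ax p) (θ p)

theorem torusHom_add {P : Type*} (ax : P → Fin 3) (θ η : P → ℝ) :
    torusHom ax (θ + η) = torusHom ax θ * torusHom ax η :=
  funext fun _ => rot_add _ _ _

theorem torusHom_zero {P : Type*} (ax : P → Fin 3) : torusHom ax 0 = 1 :=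
  funext fun _ => rot_zero _

theorem continuous_torusHom {P : Type*} (ax : P → Fin 3) : Continuous (torusHom ax) :=
  continuous_pi fun p => (continuous_rot (ax p)).comp (continuous_apply p)

theorem torusHom_neg {P : Type*} (ax : P → Fin 3) (θ : P → ℝ) :
    torusHom ax (-θ) = (torusHom ax θ)⁻¹ := by
  rw [eq_inv_iff_mul_eq_one, ← torusHom_add, neg_add_cancel, torusHom_zero]

/-- The group of all families of angles, supported on `T`, whose rotations are automorphisms of
the code. -/
def angleGroup (ax : P → Fin 3) (T : Set P) : AddSubgroup (P → ℝ) where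
  carrier := {θ | (∀ p, p ∉ T → θ p = 0) ∧ torusHom ax θ ∈ autGroup σ}
  zero_mem' := ⟨fun _ _ => rfl, by rw [torusHom_zero]; exact (autGroup σ).one_mem⟩
  add_mem' {θ η} hθ hη := ⟨fun p hp => by rw [Pi.add_apply, hθ.1 p hp, hη.1 p hp, add_zero], by
    rw [torusHom_add]; exact (autGroup σ).mul_mem hθ.2 hη.2⟩
  neg_mem' {θ} hθ := ⟨fun p hp => by rw [Pi.neg_apply, hθ.1 p hp, neg_zero], by
    rw [torusHom_neg]; exact (autGroup σ).inv_mem hθ.2⟩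

theorem isClosed_angleGroup (ax : P → Fin 3) (T : Set P) :
    IsClosed (angleGroup σ ax T : Set (P → ℝ)) := by
  have h1 : IsClosed {θ : P → ℝ | ∀ p, p ∉ T → θ p = 0} := by
    simp only [Set.ofPred_forall]
    exact isClosed_iInter fun p => isClosed_iInter fun _ =>
      isClosed_eq (continuous_apply p) continuous_const
  exact h1.inter ((isClosed_autGroup σ).preimage (continuous_torusHom ax))

theorem exists_lieGroup_logicalGroup (hL : IsIsotropic L) (hzero : ¬SplitsOffZeroFactor L) :
    ∃ (n : ℕ) (_ : ChartedSpace (EuclideanSpace ℝ (Fin n)) (LogicalGroup σ)),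
      LieGroup (𝓡 n) ∞ (LogicalGroup σ) := by
  classical
  have := t2Space_logicalGroup σ
  have hax : ∃ ax : P → Fin 3, ∀ p, (∀ g ∈ autGroup σ, g p ∈ axisStab (ax p)) ∨
      (∀ g ∈ autGroup σ, g p ∈ integralSO3) ∨ ∃ q, IsBellPair L p q := by
    have h : ∀ p, ∃ i, (∀ g ∈ autGroup σ, g p ∈ axisStab i) ∨
        (∀ g ∈ autGroup σ, g p ∈ integralSO3) ∨ ∃ q, IsBellPair L p q := by
      intro p
      rcases local_type hL hzero σ p with ⟨i, hi⟩ | h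
      · exact ⟨i, Or.inl hi⟩
      · exact ⟨0, Or.inr h⟩
    exact ⟨fun p => (h p).choose, fun p => (h p).choose_spec⟩
  obtain ⟨ax, hax⟩ := hax
  -- The qubits where small rotations can survive: reduced representatives are trivial on Bell
  -- pairs, and at the remaining qubits outside `T` integrality makes rotations near `1` trivial.
  let T : Set P := {p | (¬∃ q, IsBellPair L p q) ∧ ∀ g ∈ autGroup σ, g p ∈ axisStab (ax p)}
  let K := angleGroup σ ax T
  obtain ⟨r, hr, hlin⟩ := exists_ball_inter_subset_linearPart K (isClosed_angleGroup σ ax T)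
  let f : linearPart K → LogicalGroup σ := fun θ =>
    QuotientGroup.mk ⟨torusHom ax θ.1, (linearPart_le θ.2).2⟩
  refine exists_lieGroup_of_open_hom f (fun x y => ?_) ?_ ?_
  · have : (⟨torusHom ax (x + y).1, (linearPart_le (x + y).2).2⟩ : autGroup σ) =
        ⟨torusHom ax x.1, (linearPart_le x.2).2⟩ * ⟨torusHom ax y.1, (linearPart_le y.2).2⟩ :=
      Subtype.ext (torusHom_add ax x.1 y.1)
    simp only [f]
    rw [this]
    rfl
  · exact QuotientGroup.continuous_mk.comp
      (((continuous_torusHom ax).comp continuous_subtype_val).subtype_mk _)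
  · intro U hU
    obtain ⟨ε, hε, hεU⟩ := Metric.mem_nhds_iff.mp hU
    -- Angles below `ε` stay in the given neighbourhood `U`; angles below `r` that belong to `K` lie
    -- in its linear part.
    have hδ : 0 < min ε r := lt_min hε hr
    have hev : ∀ᶠ g : autGroup σ in 𝓝 1, ∀ p,
        (g.1 p ∈ axisStab (ax p) → ∃ θ : ℝ, |θ| < min ε r ∧ g.1 p = rot (ax p) θ) ∧
        (g.1 p ∈ integralSO3 → g.1 p = 1) := by
      refine eventually_all.mpr fun p => ?_
      have hc : Continuous fun g : autGroup σ => g.1 p :=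
        (continuous_apply p).comp continuous_subtype_val
      exact (hc.tendsto' 1 1 rfl).eventually
        ((eventually_axisStab_eq_rot (ax p) hδ).and eventually_integralSO3_eq_one)
    have himg := (QuotientGroup.isOpenMap_coe (N := scalarGroup σ)).image_mem_nhds hev
    refine mem_of_superset himg ?_
    rintro _ ⟨g, hg, rfl⟩
    obtain ⟨g', h1, h2, h3⟩ := exists_reduced_representative σ g
    have hθ : ∃ θ : P → ℝ, ∀ p, |θ p| < min ε r ∧ (p ∉ T → θ p = 0) ∧
        g'.1 p = rot (ax p) (θ p) := by
      suffices h : ∀ p, ∃ θ : ℝ, |θ| < min ε r ∧ (p ∉ T → θ = 0) ∧ g'.1 p = rot (ax p) θ from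
        ⟨fun p => (h p).choose, fun p => (h p).choose_spec⟩
      intro p
      by_cases hp : ∃ q, IsBellPair L p q
      · exact ⟨0, by simpa using hδ, fun _ => rfl, by rw [h1 p hp, rot_zero]⟩
      · rw [h2 p hp]
        by_cases hpT : p ∈ T
        · obtain ⟨θ, hθ, hgθ⟩ := (hg p).1 (hpT.2 _ g.2)
          exact ⟨θ, hθ, fun h => absurd hpT h, hgθ⟩
        · have hint : ∀ g ∈ autGroup σ, g p ∈ integralSO3 := by
            rcases hax p with h | h | h
            · exact absurd ⟨hp, h⟩ hpT
            · exact h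
            · exact absurd h hp
          exact ⟨0, by simpa using hδ, fun _ => rfl, by
            rw [(hg p).2 (hint _ g.2), rot_zero]⟩
    obtain ⟨θ, hθ⟩ := hθ
    have htor : torusHom ax θ = g'.1 := funext fun p => (hθ p).2.2.symm
    have hnorm : ‖θ‖ < min ε r :=
      (pi_norm_lt_iff hδ).mpr fun p => by rw [Real.norm_eq_abs]; exact (hθ p).1
    have hK : θ ∈ K := ⟨fun p hp => (hθ p).2.1 hp, by rw [htor]; exact g'.2⟩
    have hlinθ := hlin θ hK (hnorm.trans_le (min_le_right _ _))
    refine ⟨⟨θ, hlinθ⟩, hεU ?_, ?_⟩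
    · rw [mem_ball_zero_iff]
      exact hnorm.trans_le (min_le_left _ _)
    · rw [← h3]
      exact congrArg QuotientGroup.mk (Subtype.ext htor)

theorem isCompactLieGroup_logicalGroup (hL : IsIsotropic L) (hzero : ¬SplitsOffZeroFactor L) :
    IsCompactLieGroup (LogicalGroup σ) := by
  have := compactSpace_autGroup σ
  refine ⟨inferInstance, t2Space_logicalGroup σ, ?_, exists_lieGroup_logicalGroup σ hL hzero⟩
  have : SecondCountableTopology (autGroup σ) :=
    Topology.IsEmbedding.subtypeVal.secondCountableTopology
  infer_instance

end Lie

/-! ### Non-solvability of U(2) -/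

section NotSolvable

open Matrix ComplexConjugate

/-- The rotation by `π` with the matrix `!![0, β; -conj β, 0]`. -/
def flip (β : ℂ) (hβ : β * conj β = 1) : U2 :=
  ⟨!![0, β; -conj β, 0], by
    rw [mem_unitaryGroup_iff, star_eq_conjTranspose]
    ext a b
    fin_cases a <;> fin_cases b <;> simp [Matrix.mul_apply, hβ, mul_comm (conj β) β]⟩

/-- The rotation by `π` with the matrix `!![i, 0; 0, -i]`. -/
def diagFlip : U2 :=
  ⟨!![Complex.I, 0; 0, -Complex.I], by
    rw [mem_unitaryGroup_iff, star_eq_conjTranspose]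
    ext a b
    fin_cases a <;> fin_cases b <;> simp [Matrix.mul_apply]⟩

theorem exists_real_sqrt_half : ∃ s : ℂ, conj s = s ∧ s * s = 1 / 2 := by
  refine ⟨((Real.sqrt (1 / 2) : ℝ) : ℂ), Complex.conj_ofReal _, ?_⟩
  rw [← Complex.ofReal_mul, Real.mul_self_sqrt (by norm_num)]
  norm_num

theorem exists_conj_diagFlip (β : ℂ) (hβ : β * conj β = 1) :
    ∃ h : U2, h * diagFlip * h⁻¹ = flip β hβ := by
  obtain ⟨s, hs, hs'⟩ := exists_real_sqrt_half
  have hI : Complex.I * Complex.I = -1 := Complex.I_mul_I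
  -- The columns are unit eigenvectors of `flip β` for the eigenvalues `i` and `-i`.
  refine ⟨⟨!![s, s; s * (Complex.I * conj β), -(s * (Complex.I * conj β))], ?_⟩, ?_⟩
  · rw [mem_unitaryGroup_iff, star_eq_conjTranspose]
    ext a b
    fin_cases a <;> fin_cases b <;> simp [Matrix.mul_apply, hs]
    · linear_combination 2 * hs'
    · linear_combination (-2 * s * s * conj β * β) * hI + 2 * hs' + 2 * s * s * hβ
  · rw [mul_inv_eq_iff_eq_mul]
    apply Subtype.ext
    ext a b
    fin_cases a <;> fin_cases b <;>
      simp [diagFlip, flip]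
    · linear_combination (-s * Complex.I) * hβ
    · linear_combination (-s * Complex.I) * hβ
    · linear_combination (s * conj β) * hI
    · linear_combination (s * conj β) * hI

/-- All `flip β` are conjugate to `diagFlip`, and `diagFlip` is a commutator of two of them; so
membership passes from each derived subgroup to the next. -/
theorem diagFlip_mem_derivedSeries (n : ℕ) : diagFlip ∈ derivedSeries U2 n := by
  obtain ⟨s, hs, hs'⟩ := exists_real_sqrt_half
  have hI : Complex.I * Complex.I = -1 := Complex.I_mul_I
  -- Flips square to `-1`, so the commutator of `flip γ` and `flip β` is the square of their
  -- product, with first diagonal entry `(γ * conj β) ^ 2`. For `γ = i` and `β = exp (i π / 4)` this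
  -- is `i`.
  have hβ : (s * (1 + Complex.I)) * conj (s * (1 + Complex.I)) = 1 := by
    simp only [map_mul, hs, map_add, map_one, Complex.conj_I]
    linear_combination 2 * hs' - s * s * hI
  have hi : Complex.I * conj Complex.I = 1 := by simp
  have hcomm : flip Complex.I hi * flip _ hβ * (flip Complex.I hi)⁻¹ * (flip _ hβ)⁻¹ =
      diagFlip := by
    rw [mul_inv_eq_iff_eq_mul, mul_inv_eq_iff_eq_mul]
    apply Subtype.ext
    ext a b
    fin_cases a <;> fin_cases b <;>
      simp [diagFlip, flip, hs]
    all_goals ring_nf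
    all_goals simp
    all_goals ring
  induction n with
  | zero => simp
  | succ n ih =>
    have hflip : ∀ (β : ℂ) (hβ : β * conj β = 1), flip β hβ ∈ derivedSeries U2 n := by
      intro β hβ
      obtain ⟨h, hh⟩ := exists_conj_diagFlip β hβ
      rw [← hh]
      exact (derivedSeries_normal U2 n).conj_mem _ ih h
    rw [derivedSeries_succ, ← hcomm]
    exact Subgroup.commutator_mem_commutator (hflip _ _) (hflip _ _)

end NotSolvable

/-! ### Transversal realisations and universality -/

section Universality

open Matrix Topology

variable {P : Type*} [Fintype P] [DecidableEq P] {L : Submodule (ZMod 2) (P → V)} (σ : Sec L)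
variable {d : ℕ} (φ : code σ ≃ₗ[ℂ] StateSpace (Fin d))

/-- The local unitary operator given by `u` realises the logical operator `W` up to a phase. -/
def Realizes (u : P → U2) (W : UnitaryOn (Fin d)) : Prop :=
  ∃ c : ℂ, ‖c‖ = 1 ∧ ∀ ψ : code σ,
    act (tensorU u) (ψ : StateSpace P) = c • (φ.symm (act W (φ ψ)) : StateSpace P)

variable {σ φ}

theorem Realizes.one : Realizes σ φ 1 1 :=
  ⟨1, norm_one, fun ψ => by simp [act_one]⟩

theorem Realizes.mul {u w : P → U2} {U W : UnitaryOn (Fin d)} (hu : Realizes σ φ u U)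
    (hw : Realizes σ φ w W) : Realizes σ φ (u * w) (U * W) := by
  obtain ⟨c, hc, h1⟩ := hu
  obtain ⟨e, he, h2⟩ := hw
  refine ⟨e * c, by rw [norm_mul, hc, he, one_mul], fun ψ => ?_⟩
  rw [map_mul, act_mul, LinearMap.comp_apply, h2, map_smul, h1, smul_smul, act_mul,
    LinearEquiv.apply_symm_apply, LinearMap.comp_apply]

theorem act_act_inv {P : Type*} [Fintype P] [DecidableEq P] (U : UnitaryOn P)
    (ψ : StateSpace P) : act U (act U⁻¹ ψ) = ψ := by
  have := act_inv_act U⁻¹ ψ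
  rwa [inv_inv] at this

theorem Realizes.inv {u : P → U2} {W : UnitaryOn (Fin d)} (hu : Realizes σ φ u W) :
    Realizes σ φ u⁻¹ W⁻¹ := by
  obtain ⟨c, hc, h1⟩ := hu
  have hc0 : c ≠ 0 := norm_ne_zero_iff.mp (by rw [hc]; exact one_ne_zero)
  refine ⟨c⁻¹, by rw [norm_inv, hc, inv_one], fun ψ => ?_⟩
  have h2 := h1 (φ.symm (act W⁻¹ (φ ψ)))
  rw [LinearEquiv.apply_symm_apply, act_act_inv, LinearEquiv.symm_apply_apply] at h2
  have h3 := congrArg (act (tensorU u)⁻¹) h2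
  rw [act_inv_act, map_smul] at h3
  rw [h3, smul_smul, inv_mul_cancel₀ hc0, one_smul, map_inv]

theorem Realizes.mem_code {u : P → U2} {W : UnitaryOn (Fin d)} (hu : Realizes σ φ u W) :
    ∀ ψ ∈ code σ, act (tensorU u) ψ ∈ code σ := by
  obtain ⟨c, -, h⟩ := hu
  intro ψ hψ
  have := h ⟨ψ, hψ⟩
  change act (tensorU u) ψ = _ at this
  rw [this]
  exact (code σ).smul_mem _ (Subtype.mem _)

variable (σ φ)

/-- The group of all transversally realisable logical operators. -/
def transversalGroup : Subgroup (UnitaryOn (Fin d)) where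
  carrier := {W | ∃ u, Realizes σ φ u W}
  one_mem' := ⟨1, Realizes.one⟩
  mul_mem' := fun ⟨u, hu⟩ ⟨w, hw⟩ => ⟨u * w, hu.mul hw⟩
  inv_mem' := fun ⟨u, hu⟩ => ⟨u⁻¹, hu.inv⟩

theorem continuous_act {P : Type*} [Fintype P] [DecidableEq P] (ψ : StateSpace P) :
    Continuous fun U : UnitaryOn P => act U ψ := by
  have h1 : Continuous fun U : UnitaryOn P => U.1 *ᵥ ψ.ofLp :=
    Continuous.matrix_mulVec continuous_subtype_val continuous_const
  exact (PiLp.continuous_toLp 2 _).comp h1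

theorem isClosed_transversalGroup :
    IsClosed (transversalGroup σ φ : Set (UnitaryOn (Fin d))) := by
  have hcl : IsClosed {x : ((P → U2) × Circle) × UnitaryOn (Fin d) | ∀ ψ : code σ,
      act (tensorU x.1.1) (ψ : StateSpace P) =
        (x.1.2 : ℂ) • (φ.symm (act x.2 (φ ψ)) : StateSpace P)} := by
    simp only [Set.ofPred_forall]
    refine isClosed_iInter fun ψ => isClosed_eq ?_ ?_
    · exact (continuous_act_tensorU _).comp (continuous_fst.comp continuous_fst)
    · have h1 : Continuous fun x : ((P → U2) × Circle) × UnitaryOn (Fin d) => (x.1.2 : ℂ) :=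
        continuous_induced_dom.comp (continuous_snd.comp continuous_fst)
      have h2 : Continuous fun x : ((P → U2) × Circle) × UnitaryOn (Fin d) =>
          (φ.symm (act x.2 (φ ψ)) : StateSpace P) :=
        continuous_subtype_val.comp ((LinearMap.continuous_of_finiteDimensional
          φ.symm.toLinearMap).comp ((continuous_act (φ ψ)).comp continuous_snd))
      exact h1.smul h2
  have h := isClosedMap_snd_of_compactSpace _ hcl
  convert h using 1
  ext W
  constructor
  · rintro ⟨u, c, hc, h⟩
    exact ⟨((u, ⟨c, mem_sphere_zero_iff_norm.mpr hc⟩), W), h, rfl⟩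
  · rintro ⟨⟨⟨u, c⟩, W'⟩, h, rfl⟩
    exact ⟨u, c, Circle.norm_coe c, h⟩

/-- The realisations with error at most `1 / (n + 1)` form a decreasing sequence of nonempty compact
sets; a common point is an exact realisation. -/
theorem IsApproxTransversal.mem_transversalGroup {W : UnitaryOn (Fin d)}
    (h : IsApproxTransversal σ φ W) : W ∈ transversalGroup σ φ := by
  let K : ℕ → Set ((P → U2) × Circle) := fun n => {x | ∀ ψ : code σ,
    ‖act (tensorU x.1) (ψ : StateSpace P) - (x.2 : ℂ) • (φ.symm (act W (φ ψ)) : StateSpace P)‖ ≤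
      (1 / ((n : ℝ) + 1)) * ‖ψ‖}
  have hclosed : ∀ n, IsClosed (K n) := by
    intro n
    simp only [K, Set.ofPred_forall]
    refine isClosed_iInter fun ψ => isClosed_le ?_ continuous_const
    have h1 : Continuous fun x : (P → U2) × Circle => (x.2 : ℂ) :=
      continuous_induced_dom.comp continuous_snd
    have h2 : Continuous fun x : (P → U2) × Circle => act (tensorU x.1) (ψ : StateSpace P) :=
      (continuous_act_tensorU _).comp continuous_fst
    have h3 : Continuous fun x : (P → U2) × Circle =>
        (x.2 : ℂ) • (φ.symm (act W (φ ψ)) : StateSpace P) := h1.smul continuous_const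
    exact continuous_norm.comp (h2.sub h3)
  have hne : ∀ n, (K n).Nonempty := by
    intro n
    obtain ⟨u, c, hc, h⟩ := h (1 / ((n : ℝ) + 1)) (by positivity)
    exact ⟨(u, ⟨c, mem_sphere_zero_iff_norm.mpr hc⟩), h⟩
  have hanti : ∀ n, K (n + 1) ⊆ K n := by
    intro n x hx ψ
    refine (hx ψ).trans (mul_le_mul_of_nonneg_right ?_ (norm_nonneg _))
    refine one_div_le_one_div_of_le (by positivity) ?_
    push_cast
    linarith
  obtain ⟨⟨u, c⟩, hx⟩ := IsCompact.nonempty_iInter_of_sequence_nonempty_isCompact_isClosed K hanti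
    hne (hclosed 0).isCompact hclosed
  refine ⟨u, c, Circle.norm_coe c, fun ψ => ?_⟩
  rw [← sub_eq_zero, ← norm_le_zero_iff]
  have hlim : Filter.Tendsto (fun n : ℕ => (1 / ((n : ℝ) + 1)) * ‖ψ‖) Filter.atTop (𝓝 0) := by
    simpa using tendsto_one_div_add_atTop_nhds_zero_nat.mul_const ‖ψ‖
  exact ge_of_tendsto' hlim fun n => Set.mem_iInter.mp hx n ψ

theorem phases_subset_transversalGroup : phases d ⊆ transversalGroup σ φ := by
  rintro W ⟨c, hc⟩
  have h1 : star W.1 * W.1 = 1 := Matrix.mem_unitaryGroup_iff'.mp W.2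
  rw [hc, star_smul, star_one, smul_mul_assoc, mul_smul_comm, one_mul, smul_smul] at h1
  have h2 := congrFun (congrFun h1 0) 0
  simp only [Matrix.smul_apply, Matrix.one_apply_eq, smul_eq_mul, mul_one] at h2
  have h3 := congrArg norm h2
  rw [norm_mul, norm_star, norm_one] at h3
  have hn : ‖c‖ = 1 := by nlinarith [norm_nonneg c]
  have hc0 : c ≠ 0 := norm_ne_zero_iff.mp (by rw [hn]; exact one_ne_zero)
  have hact : ∀ χ, act W χ = c • χ := by
    intro χ
    apply WithLp.ofLp_injective 2
    rw [ofLp_act, hc, smul_mulVec, one_mulVec]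
    rfl
  refine ⟨1, c⁻¹, by rw [norm_inv, hn, inv_one], fun ψ => ?_⟩
  rw [map_one, act_one, hact, map_smul, LinearEquiv.symm_apply_apply]
  change (ψ : StateSpace P) = c⁻¹ • (c • (ψ : StateSpace P))
  rw [smul_smul, inv_mul_cancel₀ hc0, one_smul]

theorem oneQubitGate_mem_transversalGroup {j : Fin d} {𝒢 : Set (UnitaryOn (Fin d))}
    (huniv : IsUniversalOn j 𝒢) (h : ∀ W ∈ 𝒢, IsApproxTransversal σ φ W) (x : U2) :
    oneQubitGate j x ∈ transversalGroup σ φ := by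
  refine closure_minimal ?_ (isClosed_transversalGroup σ φ) (huniv x)
  refine (Subgroup.closure_le _).mpr (Set.union_subset (fun W hW => ?_)
    (phases_subset_transversalGroup σ φ))
  exact (h W hW).mem_transversalGroup σ φ

/-- If all operators on one logical qubit are transversally realisable, then the group of logical
operators is not solvable. -/
theorem not_isSolvable_of_oneQubitGate_mem (j : Fin d)
    (h : ∀ x, oneQubitGate j x ∈ transversalGroup σ φ) : ¬Group.IsSolvable (LogicalGroup σ) := by
  rintro ⟨n, hn⟩
  -- A gate does not determine its realisation `u`, so U(2) is related to the logical group by a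
  -- correspondence, which avoids a choice of realisations compatible with products.
  let D : Subgroup (U2 × (P → U2) × (P → SO3)) :=
    { carrier := {x | (∀ p, Represents (x.2.1 p) (x.2.2 p)) ∧
        Realizes σ φ x.2.1 (oneQubitGate j x.1)}
      one_mem' := ⟨fun _ => Represents.one, by
        simpa [oneQubitGate] using Realizes.one (σ := σ) (φ := φ)⟩
      mul_mem' := fun {x y} hx hy => ⟨fun p => (hx.1 p).mul (hy.1 p), by
        have := hx.2.mul hy.2
        rwa [oneQubitGate, oneQubitGate, ← map_mul, ← Pi.mulSingle_mul] at this⟩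
      inv_mem' := fun {x} hx => ⟨fun p => (hx.1 p).inv, by
        have := hx.2.inv
        rwa [oneQubitGate, ← map_inv, ← Pi.mulSingle_inv] at this⟩ }
  let π₁ : D →* U2 := (MonoidHom.fst _ _).comp D.subtype
  let π₂ : D →* LogicalGroup σ := (QuotientGroup.mk' (scalarGroup σ)).comp
    { toFun := fun x => ⟨x.1.2.2, x.1.2.1, x.2.1, x.2.2.mem_code⟩
      map_one' := rfl
      map_mul' := fun _ _ => rfl }
  have hsurj : Function.Surjective π₁ := by
    intro x
    obtain ⟨u, hu⟩ := h x
    choose g hg using fun p => exists_represents (u p)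
    exact ⟨⟨(x, u, g), hg, hu⟩, rfl⟩
  -- As `π₁` is surjective, `diagFlip` lifts to the `n`-th derived subgroup of `D`, which `π₂` sends
  -- to the trivial group.
  obtain ⟨⟨⟨x, u, g⟩, hrep, c, hc, hreal⟩, hmem, hx⟩ :=
    derivedSeries_le_map_derivedSeries hsurj n (diagFlip_mem_derivedSeries n)
  have hx' : x = diagFlip := hx
  subst hx'
  have h1 := map_derivedSeries_le_derivedSeries π₂ n (Subgroup.mem_map_of_mem _ hmem)
  rw [hn, Subgroup.mem_bot] at h1
  obtain ⟨u', hrep', e, he⟩ := (QuotientGroup.eq_one_iff _).mp h1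
  -- The scalar action is known only for some representative `u'` of the same rotations; it differs
  -- from `u` by a scalar at each qubit.
  choose a ha using fun p => (hrep' p).eq_smul (hrep p)
  have hUU : (tensorU u).1 = (∏ p, a p) • (tensorU u').1 := by
    rw [coe_tensorU, coe_tensorU, ← tensorMat_smul]
    congr 1
    funext p
    exact ha p
  have hact : ∀ ψ : code σ, act (tensorU u) (ψ : StateSpace P) =
      ((∏ p, a p) * e) • (ψ : StateSpace P) := by
    intro ψ
    rw [mul_smul, ← he ψ ψ.2]
    apply WithLp.ofLp_injective 2
    rw [ofLp_act, hUU, smul_mulVec]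
    rfl
  have hc0 : c ≠ 0 := norm_ne_zero_iff.mp (by rw [hc]; exact one_ne_zero)
  have hW : ∀ χ, act (oneQubitGate j diagFlip) χ = (c⁻¹ * ((∏ p, a p) * e)) • χ := by
    intro χ
    have h2 := hreal (φ.symm χ)
    rw [hact, LinearEquiv.apply_symm_apply] at h2
    have h3 : φ.symm (act (oneQubitGate j diagFlip) χ) =
        (c⁻¹ * ((∏ p, a p) * e)) • φ.symm χ := by
      apply Subtype.ext
      change _ = (c⁻¹ * ((∏ p, a p) * e)) • (φ.symm χ : StateSpace P)
      rw [mul_smul, h2, smul_smul, inv_mul_cancel₀ hc0, one_smul]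
    rw [← map_smul] at h3
    exact φ.symm.injective h3
  -- The diagonal entry of the gate at the constant bit string `b` is that of `diagFlip`; a scalar
  -- operator would force `i = -i`.
  have hentry : ∀ b : Fin 2, diagFlip.1 b b = c⁻¹ * ((∏ p, a p) * e) := by
    intro b
    have h2 := congrFun (congrArg WithLp.ofLp
      (hW (WithLp.toLp 2 (Pi.single (fun _ => b) 1)))) (fun _ => b)
    rw [ofLp_act] at h2
    simp only [mulVec_single_one, col_apply, WithLp.ofLp_smul, Pi.smul_apply, Pi.single_eq_same,
      smul_eq_mul, mul_one] at h2
    rw [← h2, oneQubitGate, coe_tensorU]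
    simp only [tensorMat, of_apply]
    rw [Finset.prod_eq_single j]
    · rw [Pi.mulSingle_eq_same]
    · intro p _ hp
      rw [Pi.mulSingle_eq_of_ne hp]
      exact Matrix.one_apply_eq b
    · simp
  have h3 := (hentry 0).trans (hentry 1).symm
  have h4 := congrArg Complex.im h3
  simp [diagFlip] at h4
  norm_num at h4

end Universality

end StabCode

end

theorem mainTheorem4 {P : Type*} [Fintype P] [DecidableEq P]
    (L : Submodule (ZMod 2) (P → StabCode.V)) (hL : StabCode.IsIsotropic L)
    (hzero : ¬ StabCode.SplitsOffZeroFactor L) (σ : StabCode.Sec L) :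
    (Group.IsSolvable (StabCode.LogicalGroup σ) ∧
      StabCode.IsCompactLieGroup (StabCode.LogicalGroup σ)) ∧
    ∀ d : ℕ, Module.finrank (ZMod 2) L + d = Fintype.card P →
      ∀ (φ : StabCode.code σ ≃ₗ[ℂ] StabCode.StateSpace (Fin d)) (j : Fin d)
        (𝒢 : Set (StabCode.UnitaryOn (Fin d))), StabCode.IsUniversalOn j 𝒢 →
        ¬ ∀ W ∈ 𝒢, StabCode.IsApproxTransversal σ φ W := by
  have hsolv := StabCode.isSolvable_logicalGroup hL hzero σ
  refine ⟨⟨hsolv, StabCode.isCompactLieGroup_logicalGroup σ hL hzero⟩, ?_⟩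
  intro d _ φ j 𝒢 huniv h
  exact StabCode.not_isSolvable_of_oneQubitGate_mem σ φ j
    (StabCode.oneQubitGate_mem_transversalGroup σ φ huniv h) hsolv
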